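/- Let $d\ge 1$, let $\mathbb B^d$ be the open unit ball of $\mathbb C^d$, let $\mathcal U,\mathcal Y$ be complex Hilbert spaces, and let $\mathcal L(\mathcal U,\mathcal Y)$ denote the bounded linear operators from $\mathcal U$ to $\mathcal Y$. For a Hilbert space $\mathcal Y$ let $\mathcal H_{\mathcal Y}(k_d)$ be the Drury--Arveson space of all functions $f(\lambda)=\sum_{n\in\mathbb Z_+^d}f_n\lambda^n$ on $\mathbb B^d$ with $f_n\in\mathcal Y$ and $\|f\|^2=\sum_n\frac{n!}{|n|!}\|f_n\|^2<\infty$; it is the reproducing kernel Hilbert space with kernel $k_d(\lambda,\zeta)I_{\mathcal Y}=(1-\langle\lambda,\zeta\rangle)^{-1}I_{\mathcal Y}$. A function $S:\mathbb B^d\to\mathcal L(\mathcal U,\mathcal Y)$ is called an inner multiplier if it is analytic, the multiplication operator $M_S: f(\lambda)\mapsto S(\lambda)f(\lambda)$ maps $\mathcal H_{\mathcal U}(k_d)$ into $\mathcal H_{\mathcal Y}(k_d)$ with $\|M_S\|\le 1$, and $M_S$ is a partial isometry. Theorem. A function $S:\mathbb B^d\to\mathcal L(\mathcal U,\mathcal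 Y)$ is an inner multiplier if and only if there are a Hilbert space $\mathcal X$ and a bounded operator $$\mathbf U=\begin{bmatrix}A&B\\ C&D\end{bmatrix}=\begin{bmatrix}A_1&B_1\\ \vdots&\vdots\\ A_d&B_d\\ C&D\end{bmatrix}:\mathcal X\oplus\mathcal U\to\mathcal X^d\oplus\mathcal Y$$ such that, with $Z(\lambda)=[\lambda_1I_{\mathcal X}\ \cdots\ \lambda_dI_{\mathcal X}]$: (a) $S(\lambda)=D+C(I-Z(\lambda)A)^{-1}Z(\lambda)B$ for every $\lambda\in\mathbb B^d$ (the inverse existing as a bounded operator); (b) this realization is weakly coisometric: $\mathbf U^*$ is contractive, and it is isometric on $\mathcal D\oplus\mathcal Y$, where $\mathcal D$ is the closed linear span in $\mathcal X^d$ of the vectors $Z(\zeta)^*(I-A^*Z(\zeta)^*)^{-1}C^*y$ with $\zeta\in\mathbb B^d$ and $y\in\mathcal Y$; (c) $A_iA_j=A_jA_i$ for all $i,j$, and $(A_1,\dots,A_d)$ is strongly stable: $\lim_{N\to\infty}\sum_{|n|=N}\frac{N!}{n!}\|A_1^{n_1}\cdots A_d^{n_d}x\|^2=0$ for every $x\in\mathcal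 X$; (d) the output pair $(C,A)$ is isometric: $A_1^*A_1+\cdots+A_d^*A_d+C^*C=I_{\mathcal X}$. -/

import Mathlib

open scoped InnerProduct

universe u v w

noncomputable section

namespace DruryArveson

/-- The monomial `z ^ n = z₁ ^ n₁ ⋯ z_d ^ n_d`. -/
def monomial {d : ℕ} (n : Fin d → ℕ) (z : EuclideanSpace ℂ (Fin d)) : ℂ :=
  ∏ j, z j ^ n j

/-- The open unit ball of `ℂ ^ d` (Euclidean norm). -/
abbrev unitBall (d : ℕ) : Set (EuclideanSpace ℂ (Fin d)) := Metric.ball 0 1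

/-- The `Y`-valued Drury-Arveson space `H_Y(k_d)`, i.e. the space of all functions
`f z = ∑ₙ fₙ z ^ n` on the unit ball of `ℂ ^ d` with
`‖f‖ ^ 2 = ∑ₙ (n! / |n|!) ‖fₙ‖ ^ 2 < ∞`, the reproducing kernel Hilbert space with kernel
`(1 - ⟨z, w⟩)⁻¹ I_Y`.  A function is stored through its normalised Taylor coefficients
`aₙ = √(n! / |n|!) fₙ`, so that the norm becomes the `ℓ²` norm. -/
abbrev Space (d : ℕ) (Y : Type*) [NormedAddCommGroup Y] [InnerProductSpace ℂ Y] :=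
  lp (fun _ : Fin d → ℕ => Y) 2

/-- The value at `z` of the function with normalised coefficients `a`, namely
`∑ₙ √(|n|! / n!) z ^ n aₙ`.  (`Nat.multinomial Finset.univ n` is `|n|! / n!`.) -/
def eval {d : ℕ} {Y : Type*} [NormedAddCommGroup Y] [InnerProductSpace ℂ Y]
    (a : Space d Y) (z : EuclideanSpace ℂ (Fin d)) : Y :=
  ∑' n : Fin d → ℕ, ((√(Nat.multinomial Finset.univ n : ℝ) : ℂ) * monomial n z) • a n

lemma summable_weight {d : ℕ} {z : EuclideanSpace ℂ (Fin d)} (hz : z ∈ unitBall d) :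
    Summable fun n : Fin d → ℕ =>
      ‖(√(Nat.multinomial Finset.univ n : ℝ) : ℂ) * monomial n z‖ ^ 2 := by
  have hterm : ∀ n : Fin d → ℕ,
      ‖(√(Nat.multinomial Finset.univ n : ℝ) : ℂ) * monomial n z‖ ^ 2 =
        (Nat.multinomial Finset.univ n : ℝ) * ∏ j, (‖z j‖ ^ 2) ^ n j := by
    intro n
    rw [norm_mul, mul_pow, Complex.norm_real, Real.norm_of_nonneg (Real.sqrt_nonneg _),
      Real.sq_sqrt (Nat.cast_nonneg _), monomial, norm_prod, ← Finset.prod_pow]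
    congr 1
    refine Finset.prod_congr rfl fun j _ => ?_
    rw [norm_pow, ← pow_mul, ← pow_mul, mul_comm]
  set r : ℝ := ∑ j, ‖z j‖ ^ 2 with hr
  have hr0 : 0 ≤ r := Finset.sum_nonneg fun j _ => by positivity
  have hr1 : r < 1 := by
    have h : ‖z‖ < 1 := by simpa using hz
    rw [hr, ← EuclideanSpace.norm_sq_eq]
    nlinarith [norm_nonneg z]
  simp_rw [hterm]
  refine summable_of_sum_le (c := ∑' N : ℕ, r ^ N) (fun n => by positivity) fun u => ?_
  have hsub : u ⊆ (Finset.range (u.sup (fun n => ∑ j, n j) + 1)).biUnion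
      (fun N => Finset.piAntidiag (Finset.univ : Finset (Fin d)) N) := by
    intro n hn
    simp only [Finset.mem_biUnion, Finset.mem_range, Finset.mem_piAntidiag]
    exact ⟨∑ j, n j, Nat.lt_succ_of_le (Finset.le_sup (f := fun n => ∑ j, n j) hn), rfl, by simp⟩
  refine (Finset.sum_le_sum_of_subset_of_nonneg hsub fun n _ _ => by positivity).trans ?_
  rw [Finset.sum_biUnion]
  · have : ∀ N : ℕ, ∑ n ∈ Finset.piAntidiag (Finset.univ : Finset (Fin d)) N,
        (Nat.multinomial Finset.univ n : ℝ) * ∏ j, (‖z j‖ ^ 2) ^ n j = r ^ N := fun N =>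
      (Finset.sum_pow_eq_sum_piAntidiag Finset.univ (fun j => ‖z j‖ ^ 2) N).symm
    simp_rw [this]
    exact (summable_geometric_of_lt_one hr0 hr1).sum_le_tsum _ fun N _ => by positivity
  · intro N _ M _ hNM
    refine Finset.disjoint_left.mpr fun n hn hm => hNM ?_
    exact (Finset.mem_piAntidiag.mp hn).1.symm.trans (Finset.mem_piAntidiag.mp hm).1

/-- The series that defines `eval` converges absolutely at every point of the ball. -/
lemma summable_eval {d : ℕ} {Y : Type*} [NormedAddCommGroup Y] [InnerProductSpace ℂ Y]
    (a : Space d Y) {z : EuclideanSpace ℂ (Fin d)} (hz : z ∈ unitBall d) :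
    Summable fun n : Fin d → ℕ =>
      ‖((√(Nat.multinomial Finset.univ n : ℝ) : ℂ) * monomial n z) • a n‖ := by
  have ha : Summable fun n : Fin d → ℕ => ‖a n‖ ^ 2 := by
    have := (lp.memℓp a).summable (by norm_num)
    simpa using this
  refine Summable.of_nonneg_of_le (fun n => norm_nonneg _) (fun n => ?_)
    ((summable_weight hz).add ha)
  rw [norm_smul]
  nlinarith [sq_nonneg (‖(√(Nat.multinomial Finset.univ n : ℝ) : ℂ) * monomial n z‖ - ‖a n‖),
    sq_nonneg (‖(√(Nat.multinomial Finset.univ n : ℝ) : ℂ) * monomial n z‖), sq_nonneg ‖a n‖]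

/-- A bounded operator between Hilbert spaces is a partial isometry: it is isometric on the
orthogonal complement of its kernel. -/
def IsPartialIsometry {E F : Type*} [NormedAddCommGroup E] [InnerProductSpace ℂ E]
    [NormedAddCommGroup F] [InnerProductSpace ℂ F] (T : E →L[ℂ] F) : Prop :=
  ∀ x ∈ (LinearMap.ker (T : E →ₗ[ℂ] F))ᗮ, ‖T x‖ = ‖x‖

/-- `M` is the operator of multiplication by `S` from `H_U(k_d)` to `H_Y(k_d)`. -/
def IsMultiplicationBy {d : ℕ} {U Y : Type*} [NormedAddCommGroup U] [InnerProductSpace ℂ U]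
    [NormedAddCommGroup Y] [InnerProductSpace ℂ Y]
    (S : EuclideanSpace ℂ (Fin d) → U →L[ℂ] Y) (M : Space d U →L[ℂ] Space d Y) : Prop :=
  ∀ f : Space d U, ∀ z ∈ unitBall d, eval (M f) z = S z (eval f z)

/-- `S` is an inner multiplier: an analytic function on the ball, in the Schur class
(`M_S` maps `H_U(k_d)` into `H_Y(k_d)` with norm at most `1`), for which `M_S` is a partial
isometry. Only the values of `S` on the ball matter. -/
def IsInnerMultiplier {d : ℕ} {U Y : Type*} [NormedAddCommGroup U] [InnerProductSpace ℂ U]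
    [NormedAddCommGroup Y] [InnerProductSpace ℂ Y]
    (S : EuclideanSpace ℂ (Fin d) → U →L[ℂ] Y) : Prop :=
  AnalyticOnNhd ℂ S (unitBall d) ∧
    ∃ M : Space d U →L[ℂ] Space d Y, IsMultiplicationBy S M ∧ ‖M‖ ≤ 1 ∧ IsPartialIsometry M

/-- The column operator `[T₁; …; T_d] : E → X ^ d`. -/
def column {d : ℕ} {E X : Type*} [NormedAddCommGroup E] [InnerProductSpace ℂ E]
    [NormedAddCommGroup X] [InnerProductSpace ℂ X] (T : Fin d → E →L[ℂ] X) :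
    E →L[ℂ] PiLp 2 (fun _ : Fin d => X) :=
  ((PiLp.continuousLinearEquiv 2 ℂ (fun _ : Fin d => X)).symm :
    (Fin d → X) →L[ℂ] PiLp 2 (fun _ : Fin d => X)) ∘L ContinuousLinearMap.pi T

/-- The row operator `Z(z) = [z₁ I, …, z_d I] : X ^ d → X`. -/
def rowZ {d : ℕ} (X : Type*) [NormedAddCommGroup X] [InnerProductSpace ℂ X]
    (z : EuclideanSpace ℂ (Fin d)) : PiLp 2 (fun _ : Fin d => X) →L[ℂ] X :=
  ∑ j, z j • PiLp.proj 2 (fun _ : Fin d => X) j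

/-- The blocks of a connecting operator from `X ⊕ U` to `X ^ d ⊕ Y`. -/
structure Colligation (d : ℕ) (U X Y : Type*) [NormedAddCommGroup U] [InnerProductSpace ℂ U]
    [NormedAddCommGroup X] [InnerProductSpace ℂ X]
    [NormedAddCommGroup Y] [InnerProductSpace ℂ Y] where
  /-- state operators -/
  A : Fin d → X →L[ℂ] X
  /-- input operators -/
  B : Fin d → U →L[ℂ] X
  /-- output operator -/
  C : X →L[ℂ] Y
  /-- feedthrough operator -/
  D : U →L[ℂ] Y

namespace Colligation

variable {d : ℕ} {U X Y : Type*} [NormedAddCommGroup U] [InnerProductSpace ℂ U]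
  [NormedAddCommGroup X] [InnerProductSpace ℂ X]
  [NormedAddCommGroup Y] [InnerProductSpace ℂ Y]

/-- The connecting operator `[A B; C D]`, from the Hilbert space direct sum `X ⊕ U` to the
Hilbert space direct sum `X ^ d ⊕ Y`. -/
def connecting (Q : Colligation d U X Y) :
    WithLp 2 (X × U) →L[ℂ] WithLp 2 (PiLp 2 (fun _ : Fin d => X) × Y) :=
  ((WithLp.prodContinuousLinearEquiv 2 ℂ (PiLp 2 (fun _ : Fin d => X)) Y).symm :
      PiLp 2 (fun _ : Fin d => X) × Y →L[ℂ] WithLp 2 (PiLp 2 (fun _ : Fin d => X) × Y)) ∘L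
    (((column Q.A).coprod (column Q.B)).prod (Q.C.coprod Q.D)) ∘L
    ((WithLp.prodContinuousLinearEquiv 2 ℂ X U) : WithLp 2 (X × U) →L[ℂ] X × U)

/-- `S z = D + C (I - Z(z) A)⁻¹ Z(z) B` for all `z` in the ball, the inverse existing there. -/
def Realizes (Q : Colligation d U X Y) (S : EuclideanSpace ℂ (Fin d) → U →L[ℂ] Y) : Prop :=
  ∀ z ∈ unitBall d, IsUnit (1 - rowZ X z ∘L column Q.A) ∧
    S z = Q.D + Q.C ∘L Ring.inverse (1 - rowZ X z ∘L column Q.A) ∘L rowZ X z ∘L column Q.B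

/-- The closed span in `X ^ d` of the vectors `Z(w)* (I - A* Z(w)*)⁻¹ C* y`, for `w` in the ball
and `y` in `Y`. -/
def coisometricDomain [CompleteSpace X] [CompleteSpace Y] (Q : Colligation d U X Y) :
    Submodule ℂ (PiLp 2 (fun _ : Fin d => X)) :=
  (Submodule.span ℂ
    {h | ∃ w ∈ unitBall d, ∃ y : Y,
      h = ((rowZ X w)† ∘L Ring.inverse (1 - (column Q.A)† ∘L (rowZ X w)†) ∘L Q.C†) y}
    ).topologicalClosure

/-- The adjoint of the connecting operator is contractive, and isometric on the direct sum of
`coisometricDomain` and `Y`. -/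
def IsWeaklyCoisometric [CompleteSpace U] [CompleteSpace X] [CompleteSpace Y]
    (Q : Colligation d U X Y) : Prop :=
  (∀ v, ‖(Q.connecting†) v‖ ≤ ‖v‖) ∧
    ∀ h ∈ Q.coisometricDomain, ∀ y : Y,
      ‖(Q.connecting†) (WithLp.toLp 2 (h, y))‖ = ‖WithLp.toLp 2 (h, y)‖

/-- The state operators commute with each other. -/
def IsCommutative (Q : Colligation d U X Y) : Prop :=
  ∀ i j, Commute (Q.A i) (Q.A j)

/-- `A ^ n = A₁ ^ n₁ ⋯ A_d ^ n_d`. -/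
def statePow (Q : Colligation d U X Y) (n : Fin d → ℕ) : X →L[ℂ] X :=
  (List.ofFn fun j => Q.A j ^ n j).prod

/-- `∑_{|n| = N} (N! / n!) ‖A ^ n x‖ ^ 2 → 0` as `N → ∞`, for every `x`. -/
def IsStronglyStable (Q : Colligation d U X Y) : Prop :=
  ∀ x : X, Filter.Tendsto
    (fun N : ℕ => ∑ n ∈ Finset.piAntidiag (Finset.univ : Finset (Fin d)) N,
      (Nat.multinomial Finset.univ n : ℝ) * ‖Q.statePow n x‖ ^ 2)
    Filter.atTop (nhds 0)

/-- The output pair is isometric: `A₁* A₁ + ⋯ + A_d* A_d + C* C = I`. -/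
def IsIsometricPair [CompleteSpace X] [CompleteSpace Y] (Q : Colligation d U X Y) : Prop :=
  ∑ j, (Q.A j)† ∘L Q.A j + Q.C† ∘L Q.C = 1

end Colligation

end DruryArveson

end

open scoped InnerProductSpace

noncomputable section

namespace DruryArveson

/-! ### Multinomial coefficients and summation by total degree -/

section Multinomial

variable {d : ℕ}

/-! Write G(z) = C (I - Z(z) A)⁻¹ and let J be the observability operator x ↦ G(·)x. Both directions
rest on the decomposition M M* + J J* = I of H_Y(k_d), which on kernel functions reads k(z,w)
S(z)S(w)* + G(z)G(w)* = k(z,w) I. Multiplied by 1 - ⟨z,w⟩, it becomes I - S(z)S(w)* = (1 - ⟨z,w⟩)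
G(z)G(w)*, and this says exactly that the adjoint connecting operator preserves inner products of
the vectors (Z(z)*G(z)*y, y), which it sends to (G(z)*y, S(z)*y).

From a realization, commutativity turns the powers of Z(z)A into Taylor series. The isometric pair
gives an energy balance, and strong stability makes the remainder vanish, so J is an isometry
(`exists_observability`). The kernel identity (`IsWeaklyCoisometric.kernel_identity`) yields a
contraction with first component M*. Since J J* is a projection, so is M M*
(`isPartialIsometry_of_add_eq`).

Conversely, take X = ker M*, which is invariant under the backward shifts, with A the restricted
shifts and C evaluation at 0. The pair (C, A) inherits (c) and (d) from the shifts. The Gram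
identity defines a partial isometry T on X^d ⊕ Y (`exists_partialIsometry_of_inner_eq`) whose
U-component supplies B and D. The crux of `exists_realization` is that its X-component is already
[A* C*]. -/

lemma sum_add_single (n : Fin d → ℕ) (j : Fin d) :
    ∑ i, (n + Pi.single j 1 : Fin d → ℕ) i = (∑ i, n i) + 1 := by
  simp [Finset.sum_add_distrib]

lemma multinomial_add_single_mul (n : Fin d → ℕ) (j : Fin d) :
    Nat.multinomial Finset.univ (n + Pi.single j 1) * (n j + 1) =
      ((∑ i, n i) + 1) * Nat.multinomial Finset.univ n := by
  have h1 := Nat.multinomial_spec Finset.univ (n + Pi.single j 1)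
  have h2 := Nat.multinomial_spec Finset.univ n
  rw [sum_add_single, Nat.factorial_succ, ← h2] at h1
  have h3 : ∏ i, ((n + Pi.single j 1 : Fin d → ℕ) i).factorial = (n j + 1) * ∏ i, (n i).factorial := by
    rw [Fintype.prod_eq_mul_prod_compl j, Fintype.prod_eq_mul_prod_compl j, ← mul_assoc]
    congr 1
    · simp [Nat.factorial_succ]
    · refine Finset.prod_congr rfl fun i hi => ?_
      have : i ≠ j := by simpa using hi
      simp [this]
  rw [h3] at h1
  have h4 : 0 < ∏ i, (n i).factorial := Finset.prod_pos fun i _ => Nat.factorial_pos _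
  refine Nat.eq_of_mul_eq_mul_left h4 ?_
  linear_combination h1

lemma single_le_of_ne_zero {n : Fin d → ℕ} {j : Fin d} (h : n j ≠ 0) : Pi.single j 1 ≤ n := by
  intro i
  by_cases hi : i = j
  · subst hi; simpa using Nat.one_le_iff_ne_zero.mpr h
  · simp [hi]

/-- After multiplication by |n|, the j-th summand becomes n_j times the multinomial coefficient of
n, and the n_j add up to |n|. The case split is needed because truncated subtraction fixes n when
n_j = 0. -/
lemma multinomial_eq_sum_sub_single {n : Fin d → ℕ} (hn : ∑ i, n i ≠ 0) :
    Nat.multinomial Finset.univ n =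
      ∑ j, if n j = 0 then 0 else Nat.multinomial Finset.univ (n - Pi.single j 1) := by
  refine Nat.eq_of_mul_eq_mul_left (Nat.pos_of_ne_zero hn) ?_
  rw [Finset.mul_sum, Finset.sum_mul]
  refine Finset.sum_congr rfl fun j _ => ?_
  split_ifs with h
  · simp [h]
  · obtain ⟨m, rfl⟩ : ∃ m, n = m + Pi.single j 1 :=
      ⟨n - Pi.single j 1, (tsub_add_cancel_of_le (single_le_of_ne_zero h)).symm⟩
    rw [sum_add_single, add_tsub_cancel_right, ← multinomial_add_single_mul m j, mul_comm]
    simp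

/-- The Pascal rule for multinomial sums. -/
lemma sum_multinomial_succ {E : Type*} [AddCommMonoid E] (g : (Fin d → ℕ) → E) (N : ℕ) :
    ∑ n ∈ Finset.piAntidiag (Finset.univ : Finset (Fin d)) (N + 1),
        Nat.multinomial Finset.univ n • g n =
      ∑ j, ∑ n ∈ Finset.piAntidiag (Finset.univ : Finset (Fin d)) N,
        Nat.multinomial Finset.univ n • g (n + Pi.single j 1) := by
  have h1 : ∀ j : Fin d, ∑ n ∈ Finset.piAntidiag (Finset.univ : Finset (Fin d)) N,
        Nat.multinomial Finset.univ n • g (n + Pi.single j 1) =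
      ∑ n ∈ Finset.piAntidiag (Finset.univ : Finset (Fin d)) (N + 1),
        (if n j = 0 then 0 else Nat.multinomial Finset.univ (n - Pi.single j 1)) • g n := by
    intro j
    simp_rw [ite_smul, zero_smul]
    rw [Finset.sum_ite, Finset.sum_const_zero, zero_add]
    refine Finset.sum_bij' (fun n _ => n + Pi.single j 1) (fun n _ => n - Pi.single j 1)
      ?_ ?_ ?_ ?_ ?_
    · intro n hn
      simp only [Finset.mem_piAntidiag, Finset.mem_filter] at hn ⊢
      exact ⟨⟨by rw [sum_add_single, hn.1], by simp⟩, by simp⟩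
    · intro n hn
      simp only [Finset.mem_piAntidiag, Finset.mem_filter] at hn ⊢
      refine ⟨?_, by simp⟩
      have := sum_add_single (n - Pi.single j 1) j
      rw [tsub_add_cancel_of_le (single_le_of_ne_zero hn.2), hn.1.1] at this
      exact Nat.succ_injective this.symm
    · intro n hn; exact add_tsub_cancel_right n _
    · intro n hn
      exact tsub_add_cancel_of_le (single_le_of_ne_zero (Finset.mem_filter.mp hn).2)
    · intro n hn; rw [add_tsub_cancel_right]
  simp_rw [h1]
  rw [Finset.sum_comm]
  refine Finset.sum_congr rfl fun n hn => ?_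
  rw [← Finset.sum_smul, ← multinomial_eq_sum_sub_single]
  rw [(Finset.mem_piAntidiag.mp hn).1]; simp

/-- Summation over multi-indices can be grouped by total degree. -/
lemma hasSum_degree {E : Type*} [NormedAddCommGroup E] {f : (Fin d → ℕ) → E} {a : E}
    (hf : HasSum f a) :
    HasSum (fun N : ℕ => ∑ n ∈ Finset.piAntidiag (Finset.univ : Finset (Fin d)) N, f n) a := by
  let e : (Σ N : ℕ, {n : Fin d → ℕ // ∑ i, n i = N}) ≃ (Fin d → ℕ) :=
    Equiv.sigmaFiberEquiv fun n : Fin d → ℕ => ∑ i, n i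
  have h1 : HasSum (f ∘ e) a := e.hasSum_iff.mpr hf
  refine h1.sigma fun N => ?_
  have h2 : ∀ n : Fin d → ℕ,
      n ∈ Finset.piAntidiag (Finset.univ : Finset (Fin d)) N ↔ ∑ i, n i = N := fun n => by
    simp [Finset.mem_piAntidiag]
  let _ : Fintype {n : Fin d → ℕ // ∑ i, n i = N} := Fintype.subtype _ h2
  rw [Finset.sum_subtype _ h2]
  exact hasSum_fintype _

/-- A finite set of multi-indices meets only finitely many degrees, so the degree sums bound all
finite partial sums. -/
lemma summable_of_degree {f : (Fin d → ℕ) → ℝ} (h0 : ∀ n, 0 ≤ f n)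
    (hf : Summable fun N : ℕ =>
      ∑ n ∈ Finset.piAntidiag (Finset.univ : Finset (Fin d)) N, f n) : Summable f := by
  refine summable_of_sum_le (c := ∑' N : ℕ,
    ∑ n ∈ Finset.piAntidiag (Finset.univ : Finset (Fin d)) N, f n) h0 fun u => ?_
  have hsub : u ⊆ (Finset.range (u.sup (fun n => ∑ j, n j) + 1)).biUnion
      (fun N => Finset.piAntidiag (Finset.univ : Finset (Fin d)) N) := by
    intro n hn
    simp only [Finset.mem_biUnion, Finset.mem_range, Finset.mem_piAntidiag]
    exact ⟨∑ j, n j, Nat.lt_succ_of_le (Finset.le_sup (f := fun n => ∑ j, n j) hn), rfl, by simp⟩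
  refine (Finset.sum_le_sum_of_subset_of_nonneg hsub fun n _ _ => h0 n).trans ?_
  rw [Finset.sum_biUnion]
  · exact hf.sum_le_tsum _ fun N _ => Finset.sum_nonneg fun n _ => h0 n
  · intro N _ M _ hNM
    refine Finset.disjoint_left.mpr fun n hn hm => hNM ?_
    exact (Finset.mem_piAntidiag.mp hn).1.symm.trans (Finset.mem_piAntidiag.mp hm).1

lemma exists_eq_add_single {n : Fin d → ℕ} {N : ℕ} (h : ∑ i, n i = N + 1) :
    ∃ (m : Fin d → ℕ) (j : Fin d), ∑ i, m i = N ∧ n = m + Pi.single j 1 := by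
  obtain ⟨j, -, hj⟩ : ∃ j ∈ Finset.univ, n j ≠ 0 :=
    Finset.exists_ne_zero_of_sum_ne_zero (by rw [h]; simp)
  have hn := tsub_add_cancel_of_le (single_le_of_ne_zero hj)
  refine ⟨n - Pi.single j 1, j, ?_, hn.symm⟩
  have := sum_add_single (n - Pi.single j 1) j
  rw [hn, h] at this
  exact Nat.succ_injective this.symm

lemma monomial_add_single (n : Fin d → ℕ) (j : Fin d) (z : EuclideanSpace ℂ (Fin d)) :
    monomial (n + Pi.single j 1) z = monomial n z * z j := by
  have h : ∏ i, z i ^ (Pi.single j 1 : Fin d → ℕ) i = z j := by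
    rw [Fintype.prod_eq_single j fun i hi => by simp [hi]]; simp
  simp only [monomial, Pi.add_apply, pow_add, Finset.prod_mul_distrib, h]

/-- The weight `√(|n|! / n!)` of the normalised coefficients. -/
def weight (n : Fin d → ℕ) : ℂ := (√(Nat.multinomial Finset.univ n : ℝ) : ℂ)

lemma weight_mul_self (n : Fin d → ℕ) :
    weight n * weight n = (Nat.multinomial Finset.univ n : ℂ) := by
  rw [weight, ← Complex.ofReal_mul, Real.mul_self_sqrt (Nat.cast_nonneg _)]; simp

lemma weight_ne_zero (n : Fin d → ℕ) : weight n ≠ 0 := by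
  have : (0 : ℝ) < Nat.multinomial Finset.univ n := by exact_mod_cast Nat.multinomial_pos _ _
  simpa [weight] using (Real.sqrt_pos.mpr this).ne'

lemma conj_weight (n : Fin d → ℕ) : (starRingEnd ℂ) (weight n) = weight n :=
  Complex.conj_ofReal _

lemma norm_weight_sq (n : Fin d → ℕ) :
    ‖weight n‖ ^ 2 = (Nat.multinomial Finset.univ n : ℝ) := by
  rw [weight, Complex.norm_real, Real.norm_of_nonneg (Real.sqrt_nonneg _),
      Real.sq_sqrt (Nat.cast_nonneg _)]

lemma weight_zero : weight (0 : Fin d → ℕ) = 1 := by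
  have : Nat.multinomial Finset.univ (0 : Fin d → ℕ) = 1 := by simp [Nat.multinomial]
  simp [weight, this]

/-- The ratio of the two sides is (|n| + 1) / (n_j + 1) ≥ 1. This is what makes the backward shifts
contractive. -/
lemma multinomial_le_add_single (n : Fin d → ℕ) (j : Fin d) :
    Nat.multinomial Finset.univ n ≤ Nat.multinomial Finset.univ (n + Pi.single j 1) := by
  have h := multinomial_add_single_mul n j
  have h1 : n j ≤ ∑ i, n i := Finset.single_le_sum (fun _ _ => Nat.zero_le _) (Finset.mem_univ j)
  refine Nat.le_of_mul_le_mul_left (c := n j + 1) ?_ (Nat.succ_pos _)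
  rw [mul_comm _ (Nat.multinomial _ (n + _)), h]
  exact Nat.mul_le_mul_right _ (Nat.succ_le_succ h1)

lemma norm_weight_le_add_single (n : Fin d → ℕ) (j : Fin d) :
    ‖weight n‖ ≤ ‖weight (n + Pi.single j 1)‖ := by
  refine le_of_sq_le_sq ?_ (norm_nonneg _)
  rw [norm_weight_sq, norm_weight_sq]
  exact_mod_cast multinomial_le_add_single n j

end Multinomial

/-! ### The Drury-Arveson space: kernels, evaluation, backward shifts -/

section Space

variable {d : ℕ} {Y : Type*} [NormedAddCommGroup Y] [InnerProductSpace ℂ Y]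

lemma hasSum_norm_sq (f : Space d Y) : HasSum (fun n => ‖f n‖ ^ 2) (‖f‖ ^ 2) := by
  simpa using lp.hasSum_norm (p := 2) (by norm_num) f

/-- The function with given square summable normalised coefficients. -/
def ofCoeff (a : (Fin d → ℕ) → Y) (h : Summable fun n => ‖a n‖ ^ 2) : Space d Y :=
  ⟨a, memℓp_gen (by simpa using h)⟩

@[simp]
lemma ofCoeff_apply (a : (Fin d → ℕ) → Y) (h : Summable fun n => ‖a n‖ ^ 2) (n : Fin d → ℕ) :
    ofCoeff a h n = a n := rfl

lemma ext_coeff {f g : Space d Y} (h : ∀ n, f n = g n) : f = g := lp.ext (funext h)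

@[simp]
lemma coeff_add (f g : Space d Y) (n : Fin d → ℕ) : (f + g) n = f n + g n := rfl

@[simp]
lemma coeff_smul (c : ℂ) (f : Space d Y) (n : Fin d → ℕ) : (c • f) n = c • f n := rfl

lemma hasSum_eval [CompleteSpace Y] (f : Space d Y) {z : EuclideanSpace ℂ (Fin d)}
    (hz : z ∈ unitBall d) :
    HasSum (fun n => (weight n * monomial n z) • f n) (eval f z) :=
  (summable_eval f hz).of_norm.hasSum

lemma eval_zero_right (f : Space d Y) : eval f 0 = f 0 := by
  rw [eval, tsum_eq_single 0]
  · have := weight_zero (d := d)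
    rw [weight] at this
    simp [this, monomial]
  · intro n hn
    obtain ⟨j, hj⟩ : ∃ j, n j ≠ 0 := by
      by_contra! h
      exact hn (funext h)
    have : monomial n 0 = 0 := Finset.prod_eq_zero (Finset.mem_univ j) (by simp [hj])
    simp [this]

/-- The reproducing kernel function `k_d(·, z) y`. -/
def kernel (z : unitBall d) (y : Y) : Space d Y :=
  ofCoeff (fun n => (starRingEnd ℂ (weight n * monomial n z)) • y) (by
    simp_rw [norm_smul, mul_pow, RCLike.norm_conj]
    exact (summable_weight z.2).mul_right _)

lemma kernel_apply (z : unitBall d) (y : Y) (n : Fin d → ℕ) :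
    kernel z y n = (starRingEnd ℂ (weight n * monomial n z)) • y := rfl

lemma inner_kernel_left [CompleteSpace Y] (z : unitBall d) (y : Y) (f : Space d Y) :
    ⟪kernel z y, f⟫_ℂ = ⟪y, eval f z⟫_ℂ := by
  refine (lp.hasSum_inner (kernel z y) f).unique ?_
  have := (hasSum_eval f z.2).mapL (innerSL ℂ y)
  refine this.congr_fun fun n => ?_
  simp [kernel_apply, inner_smul_left]

lemma norm_kernel_le (z : unitBall d) (y : Y) :
    ‖kernel z y‖ ≤ √(∑' n, ‖weight n * monomial n z.1‖ ^ 2) * ‖y‖ := by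
  refine le_of_sq_le_sq ?_ (by positivity)
  rw [mul_pow, Real.sq_sqrt (tsum_nonneg fun n => by positivity)]
  refine le_of_eq ((hasSum_norm_sq (kernel z y)).unique ?_)
  simp_rw [kernel_apply, norm_smul, mul_pow, RCLike.norm_conj]
  exact (summable_weight z.2).hasSum.mul_right _

variable (Y) in
/-- The kernel functions at a point, as a bounded operator of the coefficient. -/
def kernelL (z : unitBall d) : Y →L[ℂ] Space d Y :=
  LinearMap.mkContinuous
    { toFun := kernel z
      map_add' := fun x y => ext_coeff fun n => by simp [kernel_apply]
      map_smul' := fun c y => ext_coeff fun n => by simp [kernel_apply, smul_comm c] } _ (norm_kernel_le z)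

variable (Y) in
/-- Evaluation at a point of the ball, as a bounded operator. -/
def evalL [CompleteSpace Y] (z : unitBall d) : Space d Y →L[ℂ] Y := (kernelL Y z)†

lemma adjoint_evalL [CompleteSpace Y] (z : unitBall d) (y : Y) : ((evalL Y z)†) y = kernel z y := by
  rw [evalL, ContinuousLinearMap.adjoint_adjoint]; rfl

lemma evalL_apply [CompleteSpace Y] (z : unitBall d) (f : Space d Y) :
    evalL Y z f = eval f z := by
  refine ext_inner_left ℂ fun y => ?_
  rw [← ContinuousLinearMap.adjoint_inner_left, adjoint_evalL, inner_kernel_left]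

lemma norm_sum_mul_conj_lt_one (z w : unitBall d) :
    ‖∑ j, z.1 j * starRingEnd ℂ (w.1 j)‖ < 1 := by
  have h1 : ∑ j, z.1 j * starRingEnd ℂ (w.1 j) = ⟪w.1, z.1⟫_ℂ := by
    simp [PiLp.inner_apply]
  have hz : ‖z.1‖ < 1 := mem_ball_zero_iff.mp z.2
  have hw : ‖w.1‖ < 1 := mem_ball_zero_iff.mp w.2
  rw [h1]
  refine (norm_inner_le_norm _ _).trans_lt ?_
  nlinarith [norm_nonneg z.1, norm_nonneg w.1]

/-- By the multinomial theorem the degree N part is ⟨z,w⟩^N ⟨y,y'⟩, and the geometric series is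
summed. Clearing the denominator keeps later uses linear. -/
lemma inner_kernel_kernel [CompleteSpace Y] (z w : unitBall d) (y y' : Y) :
    (1 - ∑ j, z.1 j * starRingEnd ℂ (w.1 j)) * ⟪kernel z y, kernel w y'⟫_ℂ = ⟪y, y'⟫_ℂ := by
  set t := ∑ j, z.1 j * starRingEnd ℂ (w.1 j) with ht
  have ht1 : ‖t‖ < 1 := norm_sum_mul_conj_lt_one z w
  have h1 : HasSum (fun N : ℕ => ∑ n ∈ Finset.piAntidiag (Finset.univ : Finset (Fin d)) N,
      ⟪(kernel z y n : Y), kernel w y' n⟫_ℂ) ⟪kernel z y, kernel w y'⟫_ℂ :=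
    hasSum_degree (lp.hasSum_inner (kernel z y) (kernel w y'))
  have h2 := (hasSum_geometric_of_norm_lt_one ht1).mul_right ⟪y, y'⟫_ℂ
  have h3 : ∀ N : ℕ, ∑ n ∈ Finset.piAntidiag (Finset.univ : Finset (Fin d)) N,
      ⟪(kernel z y n : Y), kernel w y' n⟫_ℂ = t ^ N * ⟪y, y'⟫_ℂ := by
    intro N
    rw [ht, Finset.sum_pow_eq_sum_piAntidiag, Finset.sum_mul]
    refine Finset.sum_congr rfl fun n _ => ?_
    rw [kernel_apply, kernel_apply, inner_smul_left, inner_smul_right, ← weight_mul_self]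
    simp only [map_mul, conj_weight, monomial, map_prod, map_pow, Complex.conj_conj, mul_pow,
      Finset.prod_mul_distrib]
    ring
  simp_rw [h3] at h1
  rw [h1.unique h2, ← mul_assoc, mul_inv_cancel₀, one_mul]
  intro h
  rw [← sub_eq_zero.mp h] at ht1
  simp at ht1

/-- A function of the Drury-Arveson space determines its Taylor coefficients. -/
lemma eq_zero_of_eval_eq_zero [CompleteSpace Y] {f : Space d Y}
    (hf : ∀ z ∈ unitBall d, eval f z = 0) : f = 0 := by
  refine ext_coeff fun m => ?_
  refine ext_inner_left ℂ fun y => ?_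
  set c : (Fin d → ℕ) → ℂ := fun n => weight n * ⟪y, f n⟫_ℂ with hc
  set P : (Fin d → ℂ) → ℕ → ℂ := fun x N =>
    ∑ n ∈ Finset.piAntidiag (Finset.univ : Finset (Fin d)) N, c n * ∏ j, x j ^ n j with hP
  -- On the complex line s ↦ s x the degree N part is the N-th coefficient of a one-variable power
  -- series that vanishes near 0.
  have key : ∀ x N, P x N = 0 := by
    intro x N
    let p : FormalMultilinearSeries ℂ ℂ ℂ := fun N =>
      ContinuousMultilinearMap.mkPiRing ℂ (Fin N) (P x N)
    have hp : HasFPowerSeriesAt 0 p 0 := by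
      rw [hasFPowerSeriesAt_iff]
      have hcont : Filter.Tendsto (fun s : ℂ => s • WithLp.toLp 2 x) (nhds 0) (nhds 0) := by
        have : Continuous fun s : ℂ => s • (WithLp.toLp 2 x : EuclideanSpace ℂ (Fin d)) := by
          fun_prop
        simpa using this.tendsto 0
      filter_upwards [hcont.eventually (Metric.ball_mem_nhds _ one_pos)] with s hs
      have h1 := hasSum_degree ((hasSum_eval f hs).mapL (innerSL ℂ y))
      rw [hf _ hs] at h1
      simp only [innerSL_apply_apply, inner_zero_right] at h1
      simp only [Pi.zero_apply]
      refine h1.congr_fun fun N => ?_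
      have : p.coeff N = P x N := by simp [p, FormalMultilinearSeries.coeff]
      rw [this, hP, smul_eq_mul, Finset.mul_sum]
      refine Finset.sum_congr rfl fun n hn => ?_
      rw [inner_smul_right, hc, ← (Finset.mem_piAntidiag.mp hn).1, ← Finset.prod_pow_eq_pow_sum]
      simp only [monomial, PiLp.smul_apply, smul_eq_mul, mul_pow, Finset.prod_mul_distrib]
      ring
    have h0 := hp.eq_zero
    have h2 : p.coeff N = P x N := by simp [p, FormalMultilinearSeries.coeff]
    rw [← h2, h0]; simp [FormalMultilinearSeries.coeff]
  set N := ∑ i, m i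
  -- A homogeneous part that vanishes at every point of ℂ^d is the zero polynomial, so its
  -- coefficients vanish.
  let q : MvPolynomial (Fin d) ℂ := ∑ n ∈ Finset.piAntidiag (Finset.univ : Finset (Fin d)) N,
    MvPolynomial.monomial (Finsupp.equivFunOnFinite.symm n) (c n)
  have hq : q = 0 := by
    refine MvPolynomial.funext fun x => ?_
    have := key x N
    simp only [hP] at this
    simp only [q, map_sum, map_zero, MvPolynomial.eval_monomial]
    rw [← this]
    refine Finset.sum_congr rfl fun n _ => ?_
    rw [Finsupp.prod_fintype _ _ (by simp)]
    simp
  have hm : MvPolynomial.coeff (Finsupp.equivFunOnFinite.symm m) q = c m := by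
    simp only [q, MvPolynomial.coeff_sum, MvPolynomial.coeff_monomial,
      EmbeddingLike.apply_eq_iff_eq]
    rw [Finset.sum_ite_eq', if_pos]
    simp [Finset.mem_piAntidiag, N]
  rw [hq, MvPolynomial.coeff_zero] at hm
  have := (mul_eq_zero.mp hm.symm).resolve_left (weight_ne_zero m)
  rw [this]; simp

lemma ext_eval [CompleteSpace Y] {f g : Space d Y}
    (h : ∀ z : unitBall d, evalL Y z f = evalL Y z g) : f = g := by
  refine sub_eq_zero.mp (eq_zero_of_eval_eq_zero fun z hz => ?_)
  have := h ⟨z, hz⟩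
  rw [← evalL_apply ⟨z, hz⟩, map_sub, this, sub_self]

lemma summable_add_single {g : (Fin d → ℕ) → ℝ} (hg : Summable g) (j : Fin d) :
    Summable fun n : Fin d → ℕ => g (n + Pi.single j 1) :=
  hg.comp_injective (add_left_injective (Pi.single j 1))

lemma norm_backwardShift_coeff_le (f : (Fin d → ℕ) → Y) (j : Fin d) (n : Fin d → ℕ) :
    ‖(weight n / weight (n + Pi.single j 1)) • f (n + Pi.single j 1)‖ ^ 2 ≤
      ‖f (n + Pi.single j 1)‖ ^ 2 := by
  rw [norm_smul, mul_pow]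
  refine mul_le_of_le_one_left (by positivity) (pow_le_one₀ (norm_nonneg _) ?_)
  rw [norm_div]
  exact div_le_one_of_le₀ (norm_weight_le_add_single n j) (norm_nonneg _)

/-- The function whose `n`-th coefficient is the weighted `n + e_j`-th coefficient of `f`. -/
def backwardShiftFun (j : Fin d) (f : Space d Y) : Space d Y :=
  ofCoeff (fun n => (weight n / weight (n + Pi.single j 1)) • f (n + Pi.single j 1))
    (Summable.of_nonneg_of_le (fun n => by positivity) (norm_backwardShift_coeff_le f j)
      (summable_add_single (hasSum_norm_sq f).summable j))

lemma norm_backwardShiftFun_le (j : Fin d) (f : Space d Y) :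
    ‖backwardShiftFun j f‖ ≤ 1 * ‖f‖ := by
  rw [one_mul]
  refine le_of_sq_le_sq ?_ (norm_nonneg _)
  have h := summable_add_single (hasSum_norm_sq f).summable j
  have h1 : ‖backwardShiftFun j f‖ ^ 2 ≤ ∑' n, ‖f (n + Pi.single j 1)‖ ^ 2 :=
    hasSum_le (norm_backwardShift_coeff_le f j) (hasSum_norm_sq (backwardShiftFun j f)) h.hasSum
  rw [← (hasSum_norm_sq f).tsum_eq]
  exact h1.trans (tsum_comp_le_tsum_of_inj (f := fun n => ‖f n‖ ^ 2)
    (i := fun n => n + Pi.single j 1) (hasSum_norm_sq f).summable (fun _ => by positivity)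
    (add_left_injective (Pi.single j 1)))

variable (Y) in
/-- The adjoint of multiplication by the `j`-th coordinate function. -/
def backwardShift (j : Fin d) : Space d Y →L[ℂ] Space d Y :=
  LinearMap.mkContinuous
    { toFun := backwardShiftFun j
      map_add' := fun f g => ext_coeff fun n => by simp [backwardShiftFun]
      map_smul' := fun c f => ext_coeff fun n => by simp [backwardShiftFun, smul_comm c] } 1
    (norm_backwardShiftFun_le j)

lemma backwardShift_apply (j : Fin d) (f : Space d Y) (n : Fin d → ℕ) :
    backwardShift Y j f n =
      (weight n / weight (n + Pi.single j 1)) • f (n + Pi.single j 1) := rfl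

lemma backwardShift_kernel (j : Fin d) (z : unitBall d) (y : Y) :
    backwardShift Y j (kernel z y) = starRingEnd ℂ (z.1 j) • kernel z y := by
  refine ext_coeff fun n => ?_
  rw [backwardShift_apply, kernel_apply, coeff_smul, kernel_apply, smul_smul,
    smul_smul, monomial_add_single]
  congr 1
  simp only [map_mul, conj_weight]
  field_simp [weight_ne_zero]

lemma backwardShift_comm (i j : Fin d) (f : Space d Y) :
    backwardShift Y i (backwardShift Y j f) = backwardShift Y j (backwardShift Y i f) := by
  refine ext_coeff fun n => ?_
  simp only [backwardShift_apply, smul_smul]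
  rw [add_right_comm]
  congr 1
  field_simp [weight_ne_zero]

/-- Dual to the fact that kernel functions are joint eigenvectors of the backward shifts. -/
lemma evalL_adjoint_backwardShift [CompleteSpace Y] (j : Fin d) (z : unitBall d)
    (f : Space d Y) :
    evalL Y z (((backwardShift Y j)†) f) = z.1 j • evalL Y z f := by
  refine ext_inner_left ℂ fun y => ?_
  rw [← ContinuousLinearMap.adjoint_inner_left, adjoint_evalL,
    ContinuousLinearMap.adjoint_inner_right, backwardShift_kernel, inner_smul_left,
    Complex.conj_conj, inner_smul_right, ← ContinuousLinearMap.adjoint_inner_left, adjoint_evalL]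

/-- The backward shifts together with evaluation at the origin form an isometry. -/
lemma sum_norm_backwardShift_sq (f : Space d Y) :
    ∑ j, ‖backwardShift Y j f‖ ^ 2 + ‖f 0‖ ^ 2 = ‖f‖ ^ 2 := by
  have h1 := hasSum_degree (hasSum_norm_sq f)
  have h2 := hasSum_sum (s := Finset.univ) fun (j : Fin d) _ =>
    hasSum_degree (hasSum_norm_sq (backwardShift Y j f))
  rw [← hasSum_nat_add_iff' 1] at h1
  -- The Pascal rule, applied to the unweighted coefficients, matches degree N + 1 of f with degree
  -- N of its shifts; degree 0 is the term f(0).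
  have h3 : ∀ N : ℕ, ∑ n ∈ Finset.piAntidiag (Finset.univ : Finset (Fin d)) (N + 1), ‖f n‖ ^ 2 =
      ∑ j, ∑ n ∈ Finset.piAntidiag (Finset.univ : Finset (Fin d)) N,
        ‖backwardShift Y j f n‖ ^ 2 := by
    intro N
    have h := sum_multinomial_succ (fun n : Fin d → ℕ => ‖(weight n)⁻¹ • f n‖ ^ 2) N
    have h5 : ∀ n : Fin d → ℕ, Nat.multinomial Finset.univ n • ‖(weight n)⁻¹ • f n‖ ^ 2 =
        ‖f n‖ ^ 2 := fun n => by
      rw [nsmul_eq_mul, ← norm_weight_sq, ← mul_pow, ← norm_smul, smul_inv_smul₀ (weight_ne_zero n)]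
    have h6 : ∀ (n : Fin d → ℕ) (j : Fin d), Nat.multinomial Finset.univ n •
        ‖(weight (n + Pi.single j 1))⁻¹ • f (n + Pi.single j 1)‖ ^ 2 =
        ‖backwardShift Y j f n‖ ^ 2 := fun n j => by
      rw [nsmul_eq_mul, ← norm_weight_sq, ← mul_pow, ← norm_smul, smul_smul, ← div_eq_mul_inv,
        backwardShift_apply]
    simpa only [h5, h6] using h
  simp_rw [h3] at h1
  have h4 := h1.unique h2
  simp only [Finset.range_one, Finset.sum_singleton, Finset.piAntidiag_zero] at h4
  linarith

end Space

/-! ### Gram matrices and partial isometries -/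

section Hilbert

variable {H K : Type*} [NormedAddCommGroup H] [InnerProductSpace ℂ H] [CompleteSpace H]
  [NormedAddCommGroup K] [InnerProductSpace ℂ K] [CompleteSpace K]

omit [CompleteSpace H] [CompleteSpace K] in
lemma norm_linearCombination_eq {ι : Type*} {v : ι → H} {w : ι → K}
    (h : ∀ i j, ⟪w i, w j⟫_ℂ = ⟪v i, v j⟫_ℂ) (c : ι →₀ ℂ) :
    ‖Finsupp.linearCombination ℂ w c‖ = ‖Finsupp.linearCombination ℂ v c‖ := by
  have h2 : ⟪Finsupp.linearCombination ℂ w c, Finsupp.linearCombination ℂ w c⟫_ℂ =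
      ⟪Finsupp.linearCombination ℂ v c, Finsupp.linearCombination ℂ v c⟫_ℂ := by
    simp only [Finsupp.linearCombination_apply, Finsupp.sum, sum_inner, inner_sum,
      inner_smul_left, inner_smul_right, h]
  rw [inner_self_eq_norm_sq_to_K, inner_self_eq_norm_sq_to_K] at h2
  have h3 : ‖Finsupp.linearCombination ℂ w c‖ ^ 2 = ‖Finsupp.linearCombination ℂ v c‖ ^ 2 := by
    exact_mod_cast h2
  exact (sq_eq_sq₀ (norm_nonneg _) (norm_nonneg _)).mp h3

/-- Families with the same Gram matrix are exchanged by a partial isometry. -/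
lemma exists_partialIsometry_of_inner_eq {ι : Type*} (v : ι → H) (w : ι → K)
    (h : ∀ i j, ⟪w i, w j⟫_ℂ = ⟪v i, v j⟫_ℂ) :
    ∃ T : H →L[ℂ] K, (∀ i, T (v i) = w i) ∧
      (∀ x ∈ (Submodule.span ℂ (Set.range v)).topologicalClosure, ‖T x‖ = ‖x‖) ∧
      (∀ x, (∀ i, ⟪v i, x⟫_ℂ = 0) → T x = 0) ∧ ∀ x, ‖T x‖ ≤ ‖x‖ := by
  set E := (Submodule.span ℂ (Set.range v)).topologicalClosure with hE
  have hvE : ∀ c, Finsupp.linearCombination ℂ v c ∈ E := fun c =>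
    Submodule.le_topologicalClosure _
      (by rw [← Finsupp.range_linearCombination]; exact LinearMap.mem_range_self _ c)
  -- Formal linear combinations parametrise both spans. Although `e` need not be injective, equality
  -- of norms lets `f` factor through it and extend to the closure.
  let e : (ι →₀ ℂ) →ₗ[ℂ] E := (Finsupp.linearCombination ℂ v).codRestrict E hvE
  let f : (ι →₀ ℂ) →ₗ[ℂ] K := Finsupp.linearCombination ℂ w
  have hcl : IsClosed (E : Set H) := Submodule.isClosed_topologicalClosure _
  have : CompleteSpace E := hcl.completeSpace_coe
  have hdense : DenseRange e := by
    intro x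
    rw [Topology.IsInducing.subtypeVal.closure_eq_preimage_closure_image]
    have hx : (x : H) ∈ closure (Submodule.span ℂ (Set.range v) : Set H) := x.2
    refine closure_mono ?_ hx
    rw [← Finsupp.range_linearCombination]
    rintro _ ⟨c, rfl⟩
    exact ⟨e c, ⟨c, rfl⟩, rfl⟩
  have hnorm : ∀ c, ‖f c‖ = ‖e c‖ := fun c => norm_linearCombination_eq h c
  have hbd : ∃ C : ℝ, ∀ c, ‖f c‖ ≤ C * ‖e c‖ := ⟨1, fun c => by rw [hnorm, one_mul]⟩
  have hT0 : ∀ x : E, ‖f.extendOfNorm e x‖ = ‖x‖ := by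
    intro x
    refine hdense.induction_on x (isClosed_eq (by fun_prop) (by fun_prop)) fun c => ?_
    rw [LinearMap.extendOfNorm_eq hdense hbd, hnorm]
  have hi : ∀ i, e (Finsupp.single i 1) = ⟨v i, Submodule.le_topologicalClosure _
      (Submodule.subset_span ⟨i, rfl⟩)⟩ := fun i => Subtype.ext (by simp [e])
  refine ⟨f.extendOfNorm e ∘L E.orthogonalProjectionOnto, fun i => ?_, fun x hx => ?_,
    fun x hx => ?_, fun x => ?_⟩
  · have hm : v i ∈ E := Submodule.le_topologicalClosure _ (Submodule.subset_span ⟨i, rfl⟩)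
    have h1 : E.orthogonalProjectionOnto (v i) = e (Finsupp.single i 1) := by
      rw [hi]; exact E.orthogonalProjectionOnto_mem_subspace_eq_self ⟨v i, hm⟩
    rw [ContinuousLinearMap.comp_apply, h1, LinearMap.extendOfNorm_eq hdense hbd]
    simp [f]
  · have h1 : E.orthogonalProjectionOnto x = ⟨x, hx⟩ :=
      E.orthogonalProjectionOnto_mem_subspace_eq_self ⟨x, hx⟩
    rw [ContinuousLinearMap.comp_apply, h1, hT0]; rfl
  · have h1 : E.orthogonalProjectionOnto x = 0 := by
      rw [Submodule.orthogonalProjectionOnto_eq_zero_iff, hE, Submodule.orthogonal_closure,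
        Submodule.mem_orthogonal]
      intro u hu
      induction hu using Submodule.span_induction with
      | mem u hu => obtain ⟨i, rfl⟩ := hu; exact hx i
      | zero => simp
      | add a b _ _ ha hb => rw [inner_add_left, ha, hb, add_zero]
      | smul c a _ ha => rw [inner_smul_left, ha, mul_zero]
    rw [ContinuousLinearMap.comp_apply, h1, map_zero]
  · rw [ContinuousLinearMap.comp_apply, hT0]
    exact E.norm_orthogonalProjectionOnto_apply_le x

omit [CompleteSpace H] [CompleteSpace K] in
/-- An operator that is isometric on a subspace preserves inner products there. -/
lemma inner_map_map_of_norm_map_eq {T : H →L[ℂ] K} {N : Submodule ℂ H}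
    (hT : ∀ x ∈ N, ‖T x‖ = ‖x‖) {x y : H} (hx : x ∈ N) (hy : y ∈ N) :
    ⟪T x, T y⟫_ℂ = ⟪x, y⟫_ℂ := by
  let V : N →ₗᵢ[ℂ] K :=
    { toLinearMap := (T : H →ₗ[ℂ] K) ∘ₗ N.subtype
      norm_map' := fun a => hT a a.2 }
  exact V.inner_map_map ⟨x, hx⟩ ⟨y, hy⟩

/-- A partial isometry satisfies `M M* M = M`. -/
lemma IsPartialIsometry.comp_adjoint_comp {M : H →L[ℂ] K} (hM : IsPartialIsometry M) (x : H) :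
    M ((M†) (M x)) = M x := by
  set N := LinearMap.ker (M : H →ₗ[ℂ] K) with hN
  have hcl : IsClosed (N : Set H) := M.isClosed_ker
  have : CompleteSpace N := hcl.completeSpace_coe
  obtain ⟨a, ha, b, hb, rfl⟩ := N.exists_add_mem_mem_orthogonal x
  -- On the complement of its kernel M is isometric, and M* has range orthogonal to the kernel; so
  -- M*M is the identity there.
  have h1 : (M†) (M b) = b := by
    refine ext_inner_right ℂ fun z => ?_
    obtain ⟨a', ha', b', hb', rfl⟩ := N.exists_add_mem_mem_orthogonal z
    have h2 : ⟪M b, M b'⟫_ℂ = ⟪b, b'⟫_ℂ := inner_map_map_of_norm_map_eq hM hb hb'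
    have h3 : M a' = 0 := ha'
    rw [ContinuousLinearMap.adjoint_inner_left, map_add, h3, zero_add, h2, inner_add_right,
      Submodule.inner_left_of_mem_orthogonal ha' hb, zero_add]
  have h4 : M a = 0 := ha
  rw [map_add, h4, zero_add, h1]

lemma adjoint_comp_linearIsometry (J : H →ₗᵢ[ℂ] K) (x : H) :
    (J.toContinuousLinearMap†) (J x) = x := by
  refine ext_inner_right ℂ fun z => ?_
  rw [ContinuousLinearMap.adjoint_inner_left]
  exact J.inner_map_map x z

/-- If the ranges of `M` and of an isometry `J` are complementary in the sense that
`M M* + J J* = I`, then `M` is a contractive partial isometry. -/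
lemma isPartialIsometry_of_add_eq {L : Type*} [NormedAddCommGroup L] [InnerProductSpace ℂ L]
    [CompleteSpace L] {M : H →L[ℂ] K} (J : L →ₗᵢ[ℂ] K)
    (h : ∀ f, M ((M†) f) + J ((J.toContinuousLinearMap†) f) = f) :
    ‖M‖ ≤ 1 ∧ IsPartialIsometry M := by
  -- Since J*J = I, the hypothesis at J x leaves M M* J x = 0; pairing with J x gives ‖M* J x‖ = 0.
  have h0 : ∀ x, (M†) (J x) = 0 := fun x => by
    have h1 := h (J x)
    rw [adjoint_comp_linearIsometry, add_eq_right] at h1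
    have h2 : ⟪M ((M†) (J x)), J x⟫_ℂ = 0 := by rw [h1, inner_zero_left]
    rw [← ContinuousLinearMap.adjoint_inner_right] at h2
    exact inner_self_eq_zero.mp h2
  have h3 : ∀ x, M ((M†) (M x)) = M x := fun x => by
    have h1 := h (M x)
    have h2 : (J.toContinuousLinearMap†) (M x) = 0 := by
      refine ext_inner_right ℂ fun z => ?_
      rw [ContinuousLinearMap.adjoint_inner_left, ← ContinuousLinearMap.adjoint_inner_right]
      have := h0 z
      simp [this]
    rwa [h2, map_zero, add_zero] at h1
  have hle : ∀ f, ‖(M†) f‖ ≤ 1 * ‖f‖ := fun f => by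
    rw [one_mul]
    refine le_of_sq_le_sq ?_ (norm_nonneg _)
    have h1 : ⟪M ((M†) f) + J ((J.toContinuousLinearMap†) f), f⟫_ℂ = ⟪f, f⟫_ℂ := by rw [h f]
    have h2 : ⟪J ((J.toContinuousLinearMap†) f), f⟫_ℂ =
        ⟪(J.toContinuousLinearMap†) f, (J.toContinuousLinearMap†) f⟫_ℂ :=
      (ContinuousLinearMap.adjoint_inner_right J.toContinuousLinearMap _ f).symm
    rw [inner_add_left, h2, ← ContinuousLinearMap.adjoint_inner_right, inner_self_eq_norm_sq_to_K,
      inner_self_eq_norm_sq_to_K, inner_self_eq_norm_sq_to_K] at h1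
    have h4 : ‖(M†) f‖ ^ 2 + ‖(J.toContinuousLinearMap†) f‖ ^ 2 = ‖f‖ ^ 2 := by exact_mod_cast h1
    nlinarith [sq_nonneg ‖(J.toContinuousLinearMap†) f‖]
  refine ⟨?_, fun x hx => ?_⟩
  · have h1 := ContinuousLinearMap.opNorm_le_bound _ zero_le_one hle
    rwa [LinearIsometryEquiv.norm_map] at h1
  · have h5 : (M†) (M x) = x := by
      -- The difference lies both in ker M, by M M* M = M, and in its orthogonal complement.
      have h6 : (M†) (M x) - x ∈ LinearMap.ker (M : H →ₗ[ℂ] K) := by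
        rw [LinearMap.mem_ker]
        simp [map_sub, h3]
      have h7 : (M†) (M x) - x ∈ (LinearMap.ker (M : H →ₗ[ℂ] K))ᗮ := by
        refine Submodule.sub_mem _ ?_ hx
        rw [Submodule.mem_orthogonal]
        intro u hu
        have : M u = 0 := hu
        rw [ContinuousLinearMap.adjoint_inner_right, this, inner_zero_left]
      have h8 := Submodule.inner_right_of_mem_orthogonal h6 h7
      exact sub_eq_zero.mp (inner_self_eq_zero.mp h8)
    have h9 : ⟪M x, M x⟫_ℂ = ⟪x, x⟫_ℂ := by
      rw [← ContinuousLinearMap.adjoint_inner_left, h5]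
    rw [inner_self_eq_norm_sq_to_K, inner_self_eq_norm_sq_to_K] at h9
    have h10 : ‖M x‖ ^ 2 = ‖x‖ ^ 2 := by exact_mod_cast h9
    exact (sq_eq_sq₀ (norm_nonneg _) (norm_nonneg _)).mp h10

omit [CompleteSpace K] in
/-- An operator vanishes if it vanishes on a family and on its orthogonal complement. -/
lemma eq_zero_of_apply_eq_zero {ι : Type*} (v : ι → H) {L : H →L[ℂ] K}
    (h1 : ∀ i, L (v i) = 0) (h2 : ∀ x, (∀ i, ⟪v i, x⟫_ℂ = 0) → L x = 0) (x : H) : L x = 0 := by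
  set E := (Submodule.span ℂ (Set.range v)).topologicalClosure with hE
  have hcl : IsClosed (E : Set H) := Submodule.isClosed_topologicalClosure _
  have : CompleteSpace E := hcl.completeSpace_coe
  obtain ⟨a, ha, b, hb, rfl⟩ := E.exists_add_mem_mem_orthogonal x
  have h3 : E ≤ LinearMap.ker (L : H →ₗ[ℂ] K) := by
    refine Submodule.topologicalClosure_minimal _ ?_ L.isClosed_ker
    rw [Submodule.span_le]
    rintro _ ⟨i, rfl⟩
    exact h1 i
  have h4 : L a = 0 := h3 ha
  rw [map_add, h4, zero_add]
  refine h2 b fun i => Submodule.inner_right_of_mem_orthogonal ?_ hb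
  exact Submodule.le_topologicalClosure _ (Submodule.subset_span ⟨i, rfl⟩)

end Hilbert

/-! ### Products of commuting powers; row and column operators -/

lemma prod_ofFn_pow_add_single {M : Type*} [Monoid M] {d : ℕ} (f : Fin d → M)
    (hf : ∀ i j, Commute (f i) (f j)) (n : Fin d → ℕ) (j : Fin d) :
    (List.ofFn fun i => f i ^ (n + Pi.single j 1 : Fin d → ℕ) i).prod =
      f j * (List.ofFn fun i => f i ^ n i).prod := by
  induction d with
  | zero => exact j.elim0
  | succ d ih =>
    rw [List.ofFn_succ, List.ofFn_succ, List.prod_cons, List.prod_cons]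
    induction j using Fin.cases with
    | zero => simp [pow_succ', mul_assoc]
    | succ j =>
      have h := ih (fun i => f i.succ) (fun i j => hf _ _) (fun i => n i.succ) j
      have h1 : (fun i : Fin d => f i.succ ^ (n + Pi.single j.succ 1 : Fin (d + 1) → ℕ) i.succ) =
          fun i : Fin d => f i.succ ^ ((fun i => n i.succ) + Pi.single j 1 : Fin d → ℕ) i := by
        funext i
        congr 1
        simp [Pi.single_apply]
      rw [h1, h, ← mul_assoc, ← mul_assoc]
      congr 1
      simpa using ((hf 0 j.succ).pow_left (n 0)).eq

lemma commute_prod_ofFn_pow {M : Type*} [Monoid M] {d : ℕ} (f : Fin d → M)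
    (hf : ∀ i j, Commute (f i) (f j)) (n : Fin d → ℕ) (j : Fin d) :
    Commute (f j) (List.ofFn fun i => f i ^ n i).prod := by
  refine Commute.list_prod_right _ _ fun x hx => ?_
  obtain ⟨i, rfl⟩ := (List.mem_ofFn' _ _).mp hx
  exact (hf j i).pow_right _

section Blocks

variable {d : ℕ} {E X : Type*} [NormedAddCommGroup E] [InnerProductSpace ℂ E]
  [NormedAddCommGroup X] [InnerProductSpace ℂ X]

lemma column_apply (T : Fin d → E →L[ℂ] X) (x : E) (j : Fin d) : column T x j = T j x := rfl

lemma rowZ_apply (z : EuclideanSpace ℂ (Fin d)) (h : PiLp 2 (fun _ : Fin d => X)) :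
    rowZ X z h = ∑ j, z j • h j := by
  simp [rowZ]

lemma rowZ_zero : rowZ X (0 : EuclideanSpace ℂ (Fin d)) = 0 := by
  ext h; simp [rowZ_apply]

lemma adjoint_rowZ_apply [CompleteSpace X] (z : EuclideanSpace ℂ (Fin d)) (x : X) (j : Fin d) :
    ((rowZ X z)†) x j = starRingEnd ℂ (z j) • x := by
  have h : ((rowZ X z)†) x = WithLp.toLp 2 fun j => starRingEnd ℂ (z j) • x := by
    refine ext_inner_right ℂ fun h => ?_
    rw [ContinuousLinearMap.adjoint_inner_left, PiLp.inner_apply, rowZ_apply, inner_sum]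
    refine Finset.sum_congr rfl fun j _ => ?_
    simp [inner_smul_left, inner_smul_right]
  rw [h]

/-- The source of the factor ⟨z,w⟩ in the kernel identity. -/
lemma inner_adjoint_rowZ [CompleteSpace X] (z w : EuclideanSpace ℂ (Fin d)) (x x' : X) :
    ⟪((rowZ X z)†) x, ((rowZ X w)†) x'⟫_ℂ =
      (∑ j, z j * starRingEnd ℂ (w j)) * ⟪x, x'⟫_ℂ := by
  rw [PiLp.inner_apply, Finset.sum_mul]
  refine Finset.sum_congr rfl fun j _ => ?_
  rw [adjoint_rowZ_apply, adjoint_rowZ_apply, inner_smul_left, inner_smul_right, Complex.conj_conj,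
    mul_assoc]

lemma norm_rowZ_apply_le (z : EuclideanSpace ℂ (Fin d)) (h : PiLp 2 (fun _ : Fin d => X)) :
    ‖rowZ X z h‖ ≤ ‖z‖ * ‖h‖ := by
  rw [rowZ_apply, EuclideanSpace.norm_eq, PiLp.norm_eq_of_L2]
  refine (norm_sum_le _ _).trans ?_
  simp_rw [norm_smul]
  exact Real.sum_mul_le_sqrt_mul_sqrt _ _ _

end Blocks

/-! ### Colligations: observability, energy balance, transfer functions -/

namespace Colligation

variable {d : ℕ} {U X Y : Type*} [NormedAddCommGroup U] [InnerProductSpace ℂ U]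
  [NormedAddCommGroup X] [InnerProductSpace ℂ X]
  [NormedAddCommGroup Y] [InnerProductSpace ℂ Y] (Q : Colligation d U X Y)

lemma connecting_apply (x : X) (u : U) :
    Q.connecting (WithLp.toLp 2 (x, u)) =
      WithLp.toLp 2 (column Q.A x + column Q.B u, Q.C x + Q.D u) := rfl

section Adjoint

variable [CompleteSpace U] [CompleteSpace X] [CompleteSpace Y]

lemma adjoint_connecting_apply (h : PiLp 2 (fun _ : Fin d => X)) (y : Y) :
    (Q.connecting†) (WithLp.toLp 2 (h, y)) =
      WithLp.toLp 2 (((column Q.A)†) h + (Q.C†) y, ((column Q.B)†) h + (Q.D†) y) := by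
  refine ext_inner_right ℂ fun a => ?_
  obtain ⟨⟨x, u⟩, rfl⟩ := (WithLp.toLp_surjective 2) a
  rw [ContinuousLinearMap.adjoint_inner_left, connecting_apply, WithLp.prod_inner_apply,
    WithLp.prod_inner_apply]
  simp only [inner_add_left, inner_add_right, ContinuousLinearMap.adjoint_inner_left]
  ring

end Adjoint

lemma statePow_zero : Q.statePow 0 = 1 := by
  simp [statePow]

variable {Q}

lemma IsCommutative.statePow_add_single (hQ : Q.IsCommutative) (n : Fin d → ℕ) (j : Fin d) :
    Q.statePow (n + Pi.single j 1) = Q.A j ∘L Q.statePow n :=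
  prod_ofFn_pow_add_single Q.A hQ n j

lemma IsCommutative.statePow_add_single' (hQ : Q.IsCommutative) (n : Fin d → ℕ) (j : Fin d) :
    Q.statePow (n + Pi.single j 1) = Q.statePow n ∘L Q.A j := by
  rw [hQ.statePow_add_single]
  exact commute_prod_ofFn_pow Q.A hQ n j

/-- The multinomial theorem for the commuting operators z_j A_j, by induction with the Pascal rule.
-/
lemma IsCommutative.sum_monomial_statePow (hQ : Q.IsCommutative) (z : EuclideanSpace ℂ (Fin d))
    (N : ℕ) (x : X) :
    ∑ n ∈ Finset.piAntidiag (Finset.univ : Finset (Fin d)) N,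
      Nat.multinomial Finset.univ n • monomial n z • Q.statePow n x =
        ((rowZ X z ∘L column Q.A) ^ N) x := by
  induction N generalizing x with
  | zero => simp [Nat.multinomial, statePow_zero, monomial]
  | succ N ih =>
    rw [sum_multinomial_succ, pow_succ, mul_apply_eq_comp, ContinuousLinearMap.comp_apply,
      rowZ_apply, map_sum]
    refine Finset.sum_congr rfl fun j _ => ?_
    rw [map_smul, column_apply, ← ih, Finset.smul_sum]
    refine Finset.sum_congr rfl fun n _ => ?_
    rw [hQ.statePow_add_single', monomial_add_single, ContinuousLinearMap.comp_apply,
      smul_comm (z j), smul_smul (z j), mul_comm (z j)]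

/-- The transfer functions `C (I - Z(z) A)⁻¹` evaluate the observability operator. -/
lemma IsCommutative.evalL_observability [CompleteSpace Y] (hQ : Q.IsCommutative)
    (J : X →ₗ[ℂ] Space d Y) (hJ : ∀ x n, J x n = weight n • Q.C (Q.statePow n x))
    (z : unitBall d) (hz : IsUnit (1 - rowZ X z.1 ∘L column Q.A)) (x : X) :
    evalL Y z (J x) = (Q.C ∘L Ring.inverse (1 - rowZ X z.1 ∘L column Q.A)) x := by
  set T := rowZ X z.1 ∘L column Q.A with hT
  have h1 : ∀ x, HasSum (fun N : ℕ => Q.C ((T ^ N) x)) (evalL Y z (J x)) := by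
    intro x
    rw [evalL_apply]
    have := hasSum_degree (hasSum_eval (J x) z.2)
    refine this.congr_fun fun N => ?_
    rw [hT, ← hQ.sum_monomial_statePow, map_sum]
    refine Finset.sum_congr rfl fun n _ => ?_
    rw [hJ, smul_smul, mul_right_comm, weight_mul_self, map_nsmul, map_smul, mul_smul,
      Nat.cast_smul_eq_nsmul]
  -- The series telescopes. Its convergence comes from evaluation in the function space, so no norm
  -- bound on `T` is needed.
  have h2 : ∀ x, evalL Y z (J (x - T x)) = Q.C x := by
    intro x
    have h3 := h1 (T x)
    have h4 := (hasSum_nat_add_iff' 1).mpr (h1 x)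
    have h5 : ∀ N : ℕ, (T ^ (N + 1)) x = (T ^ N) (T x) := fun N => by rw [pow_succ]; rfl
    simp only [h5, Finset.range_one, Finset.sum_singleton, pow_zero,
      one_apply_eq_self] at h4
    rw [map_sub, map_sub, h3.unique h4, sub_sub_cancel]
  have h6 : x = Ring.inverse (1 - T) x - T (Ring.inverse (1 - T) x) := by
    have h7 := congrArg (fun L : X →L[ℂ] X => L x) (Ring.mul_inverse_cancel _ hz)
    exact h7.symm
  conv_lhs => rw [h6]
  rw [h2, ContinuousLinearMap.comp_apply]

section Isometric

variable [CompleteSpace X] [CompleteSpace Y]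

/-- Over ℂ an operator is determined by its quadratic form. -/
lemma isIsometricPair_iff :
    Q.IsIsometricPair ↔ ∀ x, ∑ j, ‖Q.A j x‖ ^ 2 + ‖Q.C x‖ ^ 2 = ‖x‖ ^ 2 := by
  have key : ∀ x, ⟪(∑ j, (Q.A j)† ∘L Q.A j + Q.C† ∘L Q.C) x, x⟫_ℂ =
      ((∑ j, ‖Q.A j x‖ ^ 2 + ‖Q.C x‖ ^ 2 : ℝ) : ℂ) := by
    intro x
    simp only [add_apply, sum_apply,
      ContinuousLinearMap.comp_apply, inner_add_left, sum_inner,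
      ContinuousLinearMap.adjoint_inner_left, inner_self_eq_norm_sq_to_K]
    push_cast
    rfl
  have hx : ∀ x : X, ⟪x, x⟫_ℂ = ((‖x‖ ^ 2 : ℝ) : ℂ) := fun x => by
    rw [inner_self_eq_norm_sq_to_K]; push_cast; rfl
  constructor
  · intro h x
    have := key x
    rw [IsIsometricPair] at h
    rw [h, one_apply_eq_self, hx] at this
    exact_mod_cast this.symm
  · intro h
    refine ContinuousLinearMap.coe_injective ((ext_inner_map _ _).mp fun x => ?_)
    have := key x
    rw [h x, ← hx] at this
    exact this

/-- The energy balance at each state A^n x, |n| = N, is weighted and summed; the Pascal rule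
collects the states A_j A^n x into degree N + 1. The differences telescope in the next lemma. -/
lemma IsIsometricPair.sum_norm_output_sq (hQ : Q.IsIsometricPair) (hc : Q.IsCommutative)
    (x : X) (N : ℕ) :
    ∑ n ∈ Finset.piAntidiag (Finset.univ : Finset (Fin d)) N,
        ‖weight n • Q.C (Q.statePow n x)‖ ^ 2 =
      ∑ n ∈ Finset.piAntidiag (Finset.univ : Finset (Fin d)) N,
        (Nat.multinomial Finset.univ n : ℝ) * ‖Q.statePow n x‖ ^ 2 -
      ∑ n ∈ Finset.piAntidiag (Finset.univ : Finset (Fin d)) (N + 1),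
        (Nat.multinomial Finset.univ n : ℝ) * ‖Q.statePow n x‖ ^ 2 := by
  have h := sum_multinomial_succ (fun n : Fin d → ℕ => ‖Q.statePow n x‖ ^ 2) N
  simp only [nsmul_eq_mul] at h
  rw [h, Finset.sum_comm, ← Finset.sum_sub_distrib]
  refine Finset.sum_congr rfl fun n _ => ?_
  rw [← Finset.mul_sum, ← mul_sub, norm_smul, mul_pow, norm_weight_sq,
    ← isIsometricPair_iff.mp hQ (Q.statePow n x)]
  simp only [hc.statePow_add_single, ContinuousLinearMap.comp_apply, add_sub_cancel_left]

/-- The output energy up to degree `N` and the state energy in degree `N` add up to `‖x‖²`. -/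
lemma IsIsometricPair.sum_range_norm_output_sq (hQ : Q.IsIsometricPair) (hc : Q.IsCommutative)
    (x : X) (N : ℕ) :
    ∑ k ∈ Finset.range N, ∑ n ∈ Finset.piAntidiag (Finset.univ : Finset (Fin d)) k,
        ‖weight n • Q.C (Q.statePow n x)‖ ^ 2 =
      ‖x‖ ^ 2 - ∑ n ∈ Finset.piAntidiag (Finset.univ : Finset (Fin d)) N,
        (Nat.multinomial Finset.univ n : ℝ) * ‖Q.statePow n x‖ ^ 2 := by
  simp_rw [hQ.sum_norm_output_sq hc]
  rw [Finset.sum_range_sub']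
  congr 1
  simp [Nat.multinomial, statePow_zero]

lemma IsIsometricPair.norm_column_le (hQ : Q.IsIsometricPair) (x : X) :
    ‖column Q.A x‖ ≤ ‖x‖ := by
  refine le_of_sq_le_sq ?_ (norm_nonneg _)
  rw [PiLp.norm_sq_eq_of_L2, ← isIsometricPair_iff.mp hQ x]
  simp only [column_apply]
  nlinarith [sq_nonneg ‖Q.C x‖]

/-- The column A is contractive, so ‖Z(z)A‖ ≤ ‖z‖ < 1. -/
lemma IsIsometricPair.isUnit (hQ : Q.IsIsometricPair) (z : unitBall d) :
    IsUnit (1 - rowZ X z.1 ∘L column Q.A) := by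
  refine isUnit_one_sub_of_norm_lt_one (lt_of_le_of_lt ?_ (mem_ball_zero_iff.mp z.2))
  refine ContinuousLinearMap.opNorm_le_bound _ (norm_nonneg _) fun x => ?_
  exact (norm_rowZ_apply_le _ _).trans
    (mul_le_mul_of_nonneg_left (hQ.norm_column_le x) (norm_nonneg _))

end Isometric

section Transfer

variable [CompleteSpace X] [CompleteSpace Y]

variable (Q) in
/-- The function `C (I - Z(z) A)⁻¹`. -/
def outputTransfer (z : unitBall d) : X →L[ℂ] Y :=
  Q.C ∘L Ring.inverse (1 - rowZ X z.1 ∘L column Q.A)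

lemma adjoint_outputTransfer (z : unitBall d) :
    (Q.outputTransfer z)† = Ring.inverse (1 - (column Q.A)† ∘L (rowZ X z.1)†) ∘L Q.C† := by
  have h : star (1 - rowZ X z.1 ∘L column Q.A) = 1 - (column Q.A)† ∘L (rowZ X z.1)† := by
    rw [star_sub, star_one, ContinuousLinearMap.star_eq_adjoint, ContinuousLinearMap.adjoint_comp]
  rw [outputTransfer, ContinuousLinearMap.adjoint_comp, ← h, Ring.inverse_star,
    ContinuousLinearMap.star_eq_adjoint]

lemma coisometricDomain_eq : Q.coisometricDomain = (Submodule.span ℂ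
    {h | ∃ (z : unitBall d) (y : Y),
      h = ((rowZ X z.1)†) (((Q.outputTransfer z)†) y)}).topologicalClosure := by
  rw [coisometricDomain]
  congr 2
  ext h
  simp only [adjoint_outputTransfer]
  constructor
  · rintro ⟨z, hz, y, rfl⟩; exact ⟨⟨z, hz⟩, y, rfl⟩
  · rintro ⟨z, y, rfl⟩; exact ⟨z.1, z.2, y, rfl⟩

/-- The adjoint form of G(z)(I - Z(z)A) = C. -/
lemma adjoint_column_outputTransfer {z : unitBall d}
    (hz : IsUnit (1 - rowZ X z.1 ∘L column Q.A)) (y : Y) :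
    ((column Q.A)†) (((rowZ X z.1)†) (((Q.outputTransfer z)†) y)) + (Q.C†) y =
      ((Q.outputTransfer z)†) y := by
  refine ext_inner_right ℂ fun x => ?_
  simp only [inner_add_left, ContinuousLinearMap.adjoint_inner_left]
  rw [← inner_add_right]
  congr 1
  have h7 := congrArg (fun L : X →L[ℂ] X => Q.C (L x)) (Ring.inverse_mul_cancel _ hz)
  simp only [mul_sub, mul_one, sub_apply, map_sub,
    one_apply_eq_self] at h7
  rw [← h7]
  simp [outputTransfer]

/-- `S(z)* = D* + B* Z(z)* (I - A* Z(z)*)⁻¹ C*` characterises the realised function. -/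
lemma realizes_iff [CompleteSpace U] {S : EuclideanSpace ℂ (Fin d) → U →L[ℂ] Y} :
    Q.Realizes S ↔ ∀ z : unitBall d, IsUnit (1 - rowZ X z.1 ∘L column Q.A) ∧
      ∀ y, ((column Q.B)†) (((rowZ X z.1)†) (((Q.outputTransfer z)†) y)) + (Q.D†) y =
        ((S z.1)†) y := by
  have key : ∀ z : unitBall d, (∀ y, ((column Q.B)†) (((rowZ X z.1)†)
      (((Q.outputTransfer z)†) y)) + (Q.D†) y = ((S z.1)†) y) ↔
      S z.1 = Q.D + Q.C ∘L Ring.inverse (1 - rowZ X z.1 ∘L column Q.A) ∘L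
        rowZ X z.1 ∘L column Q.B := by
    intro z
    have h1 : ∀ y u, ⟪((column Q.B)†) (((rowZ X z.1)†) (((Q.outputTransfer z)†) y)) + (Q.D†) y,
        u⟫_ℂ = ⟪y, (Q.D + Q.C ∘L Ring.inverse (1 - rowZ X z.1 ∘L column Q.A) ∘L
        rowZ X z.1 ∘L column Q.B) u⟫_ℂ := by
      intro y u
      simp only [inner_add_left, ContinuousLinearMap.adjoint_inner_left]
      rw [← inner_add_right, add_comm]
      rfl
    constructor
    · intro h
      ext u
      refine ext_inner_left ℂ fun y => ?_
      rw [← h1, h, ContinuousLinearMap.adjoint_inner_left]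
    · intro h y
      refine ext_inner_right ℂ fun u => ?_
      rw [h1, ← h, ContinuousLinearMap.adjoint_inner_left]
  constructor
  · intro h z; exact ⟨(h z.1 z.2).1, (key z).mpr (h z.1 z.2).2⟩
  · intro h z hz; exact ⟨(h ⟨z, hz⟩).1, (key ⟨z, hz⟩).mp (h ⟨z, hz⟩).2⟩

end Transfer

end Colligation

/-! ### From a realization to an inner multiplier -/

section

variable {d : ℕ} {U X Y : Type*} [NormedAddCommGroup U] [InnerProductSpace ℂ U]
  [NormedAddCommGroup X] [InnerProductSpace ℂ X]
  [NormedAddCommGroup Y] [InnerProductSpace ℂ Y]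

/-- Multiplication by `S` is characterised by its adjoint on kernel functions. -/
lemma isMultiplicationBy_iff [CompleteSpace U] [CompleteSpace Y]
    {S : EuclideanSpace ℂ (Fin d) → U →L[ℂ] Y} {M : Space d U →L[ℂ] Space d Y} :
    IsMultiplicationBy S M ↔ ∀ (z : unitBall d) (y : Y),
      (M†) (kernel z y) = kernel z (((S z.1)†) y) := by
  have h1 : ∀ (z : unitBall d) (y : Y) (f : Space d U),
      ⟪(M†) (kernel z y), f⟫_ℂ = ⟪y, eval (M f) z⟫_ℂ := fun z y f => by
    rw [ContinuousLinearMap.adjoint_inner_left, inner_kernel_left]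
  have h2 : ∀ (z : unitBall d) (y : Y) (f : Space d U),
      ⟪kernel z (((S z.1)†) y), f⟫_ℂ = ⟪y, S z.1 (eval f z)⟫_ℂ := fun z y f => by
    rw [inner_kernel_left, ContinuousLinearMap.adjoint_inner_left]
  constructor
  · intro h z y
    refine ext_inner_right ℂ fun f => ?_
    rw [h1, h2, h f z.1 z.2]
  · intro h f z hz
    refine ext_inner_left ℂ fun y => ?_
    rw [← h1 ⟨z, hz⟩, h, h2]

namespace Colligation

variable {Q : Colligation d U X Y}

lemma rowZ_comp_column {E : Type*} [NormedAddCommGroup E] [InnerProductSpace ℂ E]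
    (z : EuclideanSpace ℂ (Fin d)) (T : Fin d → E →L[ℂ] X) :
    rowZ X z ∘L column T = ∑ j, z j • T j := by
  ext x
  simp [rowZ_apply, column_apply]

/-- Inversion in the Banach algebra of operators on X is analytic at units; everything else is
affine in z or bounded linear. -/
lemma Realizes.analyticOnNhd [CompleteSpace X] {S : EuclideanSpace ℂ (Fin d) → U →L[ℂ] Y}
    (h : Q.Realizes S) : AnalyticOnNhd ℂ S (unitBall d) := by
  have hcoord : ∀ (j : Fin d) (z : EuclideanSpace ℂ (Fin d)),
      AnalyticAt ℂ (fun z : EuclideanSpace ℂ (Fin d) => z j) z := fun j z =>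
    (EuclideanSpace.proj j : EuclideanSpace ℂ (Fin d) →L[ℂ] ℂ).analyticAt z
  let L : Fin d → (X →L[ℂ] X) →L[ℂ] (U →L[ℂ] Y) := fun j =>
    (ContinuousLinearMap.compL ℂ U X Y Q.C) ∘L ((ContinuousLinearMap.compL ℂ U X X).flip (Q.B j))
  have hinv : ∀ z ∈ unitBall d,
      AnalyticAt ℂ (fun z => Ring.inverse (1 - ∑ j, z j • Q.A j)) z := by
    intro z hz
    obtain ⟨t, ht⟩ := (h z hz).1
    rw [rowZ_comp_column] at ht
    refine AnalyticAt.fun_comp (g := Ring.inverse) (ht ▸ analyticAt_inverse t) ?_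
    refine analyticAt_const.sub (Finset.analyticAt_fun_sum _ fun j _ => ?_)
    exact (hcoord j z).smul analyticAt_const
  have heq : ∀ z ∈ unitBall d,
      Q.D + ∑ j, z j • L j (Ring.inverse (1 - ∑ j, z j • Q.A j)) = S z := by
    intro z hz
    rw [(h z hz).2, rowZ_comp_column, rowZ_comp_column]
    congr 1
    ext u
    simp [L]
  intro z hz
  refine AnalyticAt.congr (f := fun z =>
    Q.D + ∑ j, z j • L j (Ring.inverse (1 - ∑ j, z j • Q.A j))) ?_ ?_
  · refine analyticAt_const.add (Finset.analyticAt_fun_sum _ fun j _ => ?_)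
    exact (hcoord j z).smul (((L j).analyticAt _).fun_comp (hinv z hz))
  · filter_upwards [Metric.isOpen_ball.mem_nhds hz] with w hw using heq w hw

section

variable [CompleteSpace X] [CompleteSpace Y]

/-- A strongly stable isometric pair has an isometric observability operator. -/
lemma exists_observability (hc : Q.IsCommutative) (hs : Q.IsStronglyStable)
    (hi : Q.IsIsometricPair) :
    ∃ J : X →ₗᵢ[ℂ] Space d Y, ∀ x n, J x n = weight n • Q.C (Q.statePow n x) := by
  have h1 : ∀ x, HasSum (fun k : ℕ => ∑ n ∈ Finset.piAntidiag (Finset.univ : Finset (Fin d)) k,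
      ‖weight n • Q.C (Q.statePow n x)‖ ^ 2) (‖x‖ ^ 2) := by
    intro x
    rw [hasSum_iff_tendsto_nat_of_nonneg fun N => Finset.sum_nonneg fun n _ => by positivity]
    simp_rw [hi.sum_range_norm_output_sq hc]
    simpa using tendsto_const_nhds.sub (hs x)
  have h2 : ∀ x, Summable fun n : Fin d → ℕ => ‖weight n • Q.C (Q.statePow n x)‖ ^ 2 := fun x =>
    summable_of_degree (fun n => by positivity) (h1 x).summable
  let J₀ : X →ₗ[ℂ] Space d Y :=
    { toFun := fun x => ofCoeff _ (h2 x)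
      map_add' := fun x y => ext_coeff fun n => by simp
      map_smul' := fun c x => ext_coeff fun n => by simp [smul_comm c] }
  refine ⟨⟨J₀, fun x => ?_⟩, fun x n => rfl⟩
  have h3 : ‖J₀ x‖ ^ 2 = ‖x‖ ^ 2 := (hasSum_degree (hasSum_norm_sq (J₀ x))).unique (h1 x)
  exact (sq_eq_sq₀ (norm_nonneg _) (norm_nonneg _)).mp h3

lemma IsCommutative.adjoint_observability_kernel (hc : Q.IsCommutative) {J : X →ₗᵢ[ℂ] Space d Y}
    (hJ : ∀ x n, J x n = weight n • Q.C (Q.statePow n x)) {z : unitBall d}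
    (hz : IsUnit (1 - rowZ X z.1 ∘L column Q.A)) (y : Y) :
    (J.toContinuousLinearMap†) (kernel z y) = ((Q.outputTransfer z)†) y := by
  refine ext_inner_right ℂ fun x => ?_
  rw [ContinuousLinearMap.adjoint_inner_left, ContinuousLinearMap.adjoint_inner_left,
    ← adjoint_evalL, ContinuousLinearMap.adjoint_inner_left]
  congr 1
  exact hc.evalL_observability J.toLinearMap hJ z hz x

/-- The kernel identity `I - S(z) S(w)* = (1 - ⟨z, w⟩) G(z) G(w)*`. -/
lemma IsWeaklyCoisometric.kernel_identity [CompleteSpace U] (hw : Q.IsWeaklyCoisometric)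
    {S : EuclideanSpace ℂ (Fin d) → U →L[ℂ] Y} (hS : Q.Realizes S) (z w : unitBall d) (y y' : Y) :
    (1 - ∑ j, z.1 j * starRingEnd ℂ (w.1 j)) *
        ⟪((Q.outputTransfer z)†) y, ((Q.outputTransfer w)†) y'⟫_ℂ =
      ⟪y, y'⟫_ℂ - ⟪((S z.1)†) y, ((S w.1)†) y'⟫_ℂ := by
  let N : Submodule ℂ (WithLp 2 (PiLp 2 (fun _ : Fin d => X) × Y)) :=
    Q.coisometricDomain.comap (WithLp.fstₗ 2 ℂ _ _)
  have hN : ∀ v ∈ N, ‖(Q.connecting†) v‖ = ‖v‖ := by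
    intro v hv
    obtain ⟨⟨h, y⟩, rfl⟩ := (WithLp.toLp_surjective 2) v
    exact hw.2 h hv y
  have hmem : ∀ (z : unitBall d) (y : Y),
      WithLp.toLp 2 (((rowZ X z.1)†) (((Q.outputTransfer z)†) y), y) ∈ N := fun z y => by
    change ((rowZ X z.1)†) (((Q.outputTransfer z)†) y) ∈ Q.coisometricDomain
    rw [coisometricDomain_eq]
    exact Submodule.le_topologicalClosure _ (Submodule.subset_span ⟨z, y, rfl⟩)
  have himg : ∀ (z : unitBall d) (y : Y),
      (Q.connecting†) (WithLp.toLp 2 (((rowZ X z.1)†) (((Q.outputTransfer z)†) y), y)) =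
        WithLp.toLp 2 (((Q.outputTransfer z)†) y, ((S z.1)†) y) := fun z y => by
    rw [adjoint_connecting_apply, adjoint_column_outputTransfer (realizes_iff.mp hS z).1,
      (realizes_iff.mp hS z).2]
  have h := inner_map_map_of_norm_map_eq hN (hmem z y) (hmem w y')
  rw [himg, himg, WithLp.prod_inner_apply, WithLp.prod_inner_apply] at h
  simp only [inner_adjoint_rowZ] at h
  linear_combination h

/-- A function with a weakly coisometric, commutative, strongly stable realization with isometric
output pair is an inner multiplier. -/
theorem isInnerMultiplier [CompleteSpace U] {S : EuclideanSpace ℂ (Fin d) → U →L[ℂ] Y}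
    (hS : Q.Realizes S) (hw : Q.IsWeaklyCoisometric) (hc : Q.IsCommutative)
    (hs : Q.IsStronglyStable) (hi : Q.IsIsometricPair) : IsInnerMultiplier S := by
  refine ⟨hS.analyticOnNhd, ?_⟩
  obtain ⟨J, hJ⟩ := exists_observability hc hs hi
  have hJk : ∀ (z : unitBall d) (y : Y),
      (J.toContinuousLinearMap†) (kernel z y) = ((Q.outputTransfer z)†) y := fun z y =>
    hc.adjoint_observability_kernel hJ (hS z.1 z.2).1 y
  have hgram : ∀ (z w : unitBall d) (y y' : Y),
      ⟪kernel z (((S z.1)†) y), kernel w (((S w.1)†) y')⟫_ℂ +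
        ⟪((Q.outputTransfer z)†) y, ((Q.outputTransfer w)†) y'⟫_ℂ =
      ⟪kernel z y, kernel w y'⟫_ℂ := by
    intro z w y y'
    have h0 : 1 - ∑ j, z.1 j * starRingEnd ℂ (w.1 j) ≠ 0 := fun h => by
      have h1 := norm_sum_mul_conj_lt_one z w
      rw [← sub_eq_zero.mp h] at h1
      simp at h1
    refine mul_left_cancel₀ h0 ?_
    rw [mul_add, inner_kernel_kernel, inner_kernel_kernel, hw.kernel_identity hS]
    ring
  -- The Gram identity gives an operator k_z y ↦ (k_z S(z)*y, G(z)*y); the adjoint of its first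
  -- component is multiplication by S.
  obtain ⟨T, hT, -⟩ := exists_partialIsometry_of_inner_eq
    (fun i : unitBall d × Y => kernel i.1 i.2)
    (fun i => WithLp.toLp 2 (kernel i.1 (((S i.1.1)†) i.2), ((Q.outputTransfer i.1)†) i.2))
    fun i j => hgram i.1 j.1 i.2 j.2
  let M : Space d U →L[ℂ] Space d Y := (WithLp.fstL 2 ℂ (Space d U) X ∘L T)†
  have hM : ∀ (z : unitBall d) (y : Y), (M†) (kernel z y) = kernel z (((S z.1)†) y) := by
    intro z y
    have h1 : M† = WithLp.fstL 2 ℂ (Space d U) X ∘L T := ContinuousLinearMap.adjoint_adjoint _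
    rw [h1, ContinuousLinearMap.comp_apply, hT (z, y)]
    rfl
  have hker : ∀ (z : unitBall d) (y : Y),
      M ((M†) (kernel z y)) + J ((J.toContinuousLinearMap†) (kernel z y)) = kernel z y := by
    intro z y
    refine ext_eval fun w => ext_inner_left ℂ fun y' => ?_
    rw [← ContinuousLinearMap.adjoint_inner_left, ← ContinuousLinearMap.adjoint_inner_left,
      adjoint_evalL, ← hgram, inner_add_right, ← ContinuousLinearMap.adjoint_inner_left, hM, hM]
    congr 1
    have h1 : ⟪kernel w y', J ((J.toContinuousLinearMap†) (kernel z y))⟫_ℂ =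
        ⟪(J.toContinuousLinearMap†) (kernel w y'), (J.toContinuousLinearMap†) (kernel z y)⟫_ℂ :=
      (ContinuousLinearMap.adjoint_inner_left J.toContinuousLinearMap _ _).symm
    rw [h1, hJk, hJk]
  -- M M* + J J* is self-adjoint, so pairing with kernel functions moves the identity from kernels
  -- to every f.
  have hall : ∀ f, M ((M†) f) + J ((J.toContinuousLinearMap†) f) = f := by
    intro f
    refine ext_eval fun z => ext_inner_left ℂ fun y => ?_
    rw [← ContinuousLinearMap.adjoint_inner_left, ← ContinuousLinearMap.adjoint_inner_left,
      adjoint_evalL]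
    nth_rw 2 [← hker z y]
    rw [inner_add_left, inner_add_right]
    exact congrArg₂ (· + ·)
      ((ContinuousLinearMap.adjoint_inner_left M _ _).symm.trans
        (ContinuousLinearMap.adjoint_inner_right M _ _))
      ((ContinuousLinearMap.adjoint_inner_left J.toContinuousLinearMap _ _).symm.trans
        (ContinuousLinearMap.adjoint_inner_right J.toContinuousLinearMap _ _))
  obtain ⟨h1, h2⟩ := isPartialIsometry_of_add_eq J hall
  exact ⟨M, isMultiplicationBy_iff.mpr hM, h1, h2⟩

end

end Colligation

end

/-! ### From an inner multiplier to a realization -/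

section

/-- Every Hilbert space is isometric to one in any higher universe. -/
lemma exists_linearIsometryEquiv_lift (E : Type v) [NormedAddCommGroup E] [InnerProductSpace ℂ E]
    [CompleteSpace E] :
    ∃ (X : Type (max v w)) (_ : NormedAddCommGroup X) (_ : InnerProductSpace ℂ X)
      (_ : CompleteSpace X), Nonempty (X ≃ₗᵢ[ℂ] E) := by
  refine ⟨PiLp 2 (fun _ : PUnit.{w + 1} => E), inferInstance, inferInstance, inferInstance, ⟨?_⟩⟩
  exact
    { toLinearEquiv := (WithLp.linearEquiv 2 ℂ (PUnit.{w + 1} → E)).trans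
        (LinearEquiv.funUnique PUnit.{w + 1} ℂ E)
      norm_map' := fun x => by
        rw [PiLp.norm_eq_of_L2]
        simp }

variable {d : ℕ} {U X Y : Type*} [NormedAddCommGroup U] [InnerProductSpace ℂ U]
  [NormedAddCommGroup X] [InnerProductSpace ℂ X]
  [NormedAddCommGroup Y] [InnerProductSpace ℂ Y]

namespace Colligation

variable {Q : Colligation d U X Y}

section Model

variable {J : X →ₗᵢ[ℂ] Space d Y} (hA : ∀ j x, J (Q.A j x) = backwardShift Y j (J x))
  (hC : ∀ x, Q.C x = J x 0)

include hA in
lemma isCommutative_of_backwardShift : Q.IsCommutative := by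
  intro i j
  ext x
  refine J.injective ?_
  change J (Q.A i (Q.A j x)) = J (Q.A j (Q.A i x))
  rw [hA, hA, hA, hA, backwardShift_comm]

include hA hC in
-- An intertwining J is necessarily the observability operator of (C, A): iterated backward shifts
-- carry the n-th coefficient to the origin, up to weight.
lemma coeff_of_backwardShift (x : X) (n : Fin d → ℕ) :
    J x n = weight n • Q.C (Q.statePow n x) := by
  obtain ⟨N, hN⟩ : ∃ N, ∑ i, n i = N := ⟨_, rfl⟩
  induction N generalizing n x with
  | zero =>
    have h0 : n = 0 := funext fun i => by simpa using Finset.sum_eq_zero_iff.mp hN i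
    subst h0
    rw [weight_zero, statePow_zero, hC, one_smul]; rfl
  | succ N ih =>
    obtain ⟨m, j, hm, rfl⟩ := exists_eq_add_single hN
    have h1 := ih (Q.A j x) m hm
    rw [hA, backwardShift_apply] at h1
    rw [(isCommutative_of_backwardShift hA).statePow_add_single', ContinuousLinearMap.comp_apply]
    have h2 : weight m ≠ 0 := weight_ne_zero m
    have h3 : weight (m + Pi.single j 1) ≠ 0 := weight_ne_zero _
    have h4 := congrArg (fun y => (weight (m + Pi.single j 1) / weight m) • y) h1
    simp only [smul_smul] at h4
    rwa [div_mul_div_cancel₀ h2, div_self h3, one_smul, div_mul_cancel₀ _ h2] at h4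

variable [CompleteSpace X] [CompleteSpace Y]

include hA hC in
lemma isIsometricPair_of_backwardShift : Q.IsIsometricPair := by
  refine isIsometricPair_iff.mpr fun x => ?_
  have h := sum_norm_backwardShift_sq (J x)
  simp_rw [← hA, LinearIsometry.norm_map, ← hC] at h
  exact h

include hA hC in
-- The total output energy is ‖Jx‖² = ‖x‖², so the energy balance leaves nothing for the state in
-- the limit.
lemma isStronglyStable_of_backwardShift : Q.IsStronglyStable := by
  intro x
  have h1 := (hasSum_degree (hasSum_norm_sq (J x))).tendsto_sum_nat
  simp_rw [coeff_of_backwardShift hA hC] at h1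
  simp_rw [(isIsometricPair_of_backwardShift hA hC).sum_range_norm_output_sq
    (isCommutative_of_backwardShift hA)] at h1
  have h2 := (tendsto_const_nhds (x := ‖x‖ ^ 2)).sub h1
  simpa using h2

end Model

end Colligation

section Range

variable [CompleteSpace U] [CompleteSpace Y] {S : EuclideanSpace ℂ (Fin d) → U →L[ℂ] Y}
  {M : Space d U →L[ℂ] Space d Y}

/-- Adjoints of multiplication operators commute with the backward shifts. -/
lemma IsMultiplicationBy.adjoint_backwardShift (hM : IsMultiplicationBy S M) (j : Fin d)
    (f : Space d Y) : (M†) (backwardShift Y j f) = backwardShift U j ((M†) f) := by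
  refine ext_inner_right ℂ fun g => ?_
  rw [ContinuousLinearMap.adjoint_inner_left, ← ContinuousLinearMap.adjoint_inner_right,
    ← ContinuousLinearMap.adjoint_inner_right, ContinuousLinearMap.adjoint_inner_left]
  congr 1
  refine ext_eval fun z => ?_
  rw [evalL_adjoint_backwardShift, evalL_apply, evalL_apply, hM _ _ z.2, hM _ _ z.2,
    ← evalL_apply z ((backwardShift U j†) g), evalL_adjoint_backwardShift, map_smul, evalL_apply]

variable [CompleteSpace X] {J : X →ₗᵢ[ℂ] Space d Y}

/-- M M* M = M puts f - M M* f in ker M*, the range of J, while J* annihilates the range of M. -/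
lemma linearIsometry_adjoint_add (hpi : IsPartialIsometry M)
    (hJ : ∀ f, f ∈ Set.range J ↔ (M†) f = 0) (f : Space d Y) :
    J ((J.toContinuousLinearMap†) f) + M ((M†) f) = f := by
  have h1 : (M†) (f - M ((M†) f)) = 0 := by
    refine ext_inner_right ℂ fun g => ?_
    rw [ContinuousLinearMap.adjoint_inner_left, inner_sub_left,
      ← ContinuousLinearMap.adjoint_inner_right M, ContinuousLinearMap.adjoint_inner_left,
      hpi.comp_adjoint_comp, sub_self, inner_zero_left]
  obtain ⟨x, hx⟩ := (hJ _).mpr h1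
  have h2 : (J.toContinuousLinearMap†) (M ((M†) f)) = 0 := by
    refine ext_inner_right ℂ fun z => ?_
    rw [ContinuousLinearMap.adjoint_inner_left, ← ContinuousLinearMap.adjoint_inner_right]
    have h3 : (M†) (J.toContinuousLinearMap z) = 0 := (hJ _).mp ⟨z, rfl⟩
    rw [h3, inner_zero_left, inner_zero_right]
  have h4 : (J.toContinuousLinearMap†) f = x := by
    have h5 : f = J x + M ((M†) f) := by rw [hx]; abel
    rw [h5, map_add, h2, add_zero, adjoint_comp_linearIsometry]
  rw [h4, hx]; abel

namespace Colligation

variable (U) in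
/-- The backward shift restricted to the range of `J`, with no input. -/
def outputModel (J : X →ₗᵢ[ℂ] Space d Y) : Colligation d U X Y where
  A j := J.toContinuousLinearMap† ∘L backwardShift Y j ∘L J.toContinuousLinearMap
  -- Placeholders: only A and C matter until `withInput` supplies B and D.
  B _ := 0
  C := evalL Y ⟨0, Metric.mem_ball_self one_pos⟩ ∘L J.toContinuousLinearMap
  D := 0

/-- Add input and feedthrough operators, given by the adjoint of the operator they form. -/
def withInput (Q : Colligation d U X Y)
    (R : WithLp 2 (PiLp 2 (fun _ : Fin d => X) × Y) →L[ℂ] U) : Colligation d U X Y where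
  A := Q.A
  B j := PiLp.proj 2 (fun _ : Fin d => X) j ∘L
    (R ∘L ((WithLp.prodContinuousLinearEquiv 2 ℂ (PiLp 2 (fun _ : Fin d => X)) Y).symm :
      PiLp 2 (fun _ : Fin d => X) × Y →L[ℂ] WithLp 2 (PiLp 2 (fun _ : Fin d => X) × Y)) ∘L
      ContinuousLinearMap.inl ℂ _ _)†
  C := Q.C
  D := (R ∘L ((WithLp.prodContinuousLinearEquiv 2 ℂ (PiLp 2 (fun _ : Fin d => X)) Y).symm :
      PiLp 2 (fun _ : Fin d => X) × Y →L[ℂ] WithLp 2 (PiLp 2 (fun _ : Fin d => X) × Y)) ∘L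
      ContinuousLinearMap.inr ℂ _ _)†

lemma adjoint_withInput_apply (Q : Colligation d U X Y)
    (R : WithLp 2 (PiLp 2 (fun _ : Fin d => X) × Y) →L[ℂ] U)
    (h : PiLp 2 (fun _ : Fin d => X)) (y : Y) :
    ((column (Q.withInput R).B)†) h + ((Q.withInput R).D†) y = R (WithLp.toLp 2 (h, y)) := by
  have h1 : column (Q.withInput R).B =
      (R ∘L ((WithLp.prodContinuousLinearEquiv 2 ℂ (PiLp 2 (fun _ : Fin d => X)) Y).symm :
      PiLp 2 (fun _ : Fin d => X) × Y →L[ℂ] WithLp 2 (PiLp 2 (fun _ : Fin d => X) × Y)) ∘L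
      ContinuousLinearMap.inl ℂ _ _)† := by
    ext u j; rfl
  rw [h1, withInput, ContinuousLinearMap.adjoint_adjoint, ContinuousLinearMap.adjoint_adjoint]
  simp only [ContinuousLinearMap.comp_apply, ContinuousLinearMap.inl_apply,
    ContinuousLinearMap.inr_apply]
  rw [← map_add, ← map_add, Prod.mk_add_mk, add_zero, zero_add]
  rfl

omit [CompleteSpace U] in
lemma outputModel_C_apply (x : X) : (outputModel U J).C x = J x 0 := by
  change evalL Y ⟨0, _⟩ (J x) = _
  rw [evalL_apply]
  exact eval_zero_right _

/-- M* intertwines the backward shifts, so ker M* is invariant and the compression in the definition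
is a restriction. -/
lemma outputModel_A_apply (hM : IsMultiplicationBy S M)
    (hJ : ∀ f, f ∈ Set.range J ↔ (M†) f = 0) (j : Fin d) (x : X) :
    J ((outputModel U J).A j x) = backwardShift Y j (J x) := by
  obtain ⟨x', hx'⟩ := (hJ (backwardShift Y j (J x))).mpr (by
    rw [hM.adjoint_backwardShift, (hJ _).mp ⟨x, rfl⟩, map_zero])
  change J ((J.toContinuousLinearMap†) (backwardShift Y j (J x))) = _
  rw [← hx', adjoint_comp_linearIsometry]

/-- An inner multiplier has a realization on any model of the orthogonal complement of the range
of its multiplication operator. -/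
theorem exists_realization (hM : IsMultiplicationBy S M) (hpi : IsPartialIsometry M)
    (hJ : ∀ f, f ∈ Set.range J ↔ (M†) f = 0) :
    ∃ Q : Colligation d U X Y, Q.Realizes S ∧ Q.IsWeaklyCoisometric ∧
      Q.IsCommutative ∧ Q.IsStronglyStable ∧ Q.IsIsometricPair := by
  set Q₀ := outputModel U J with hQ₀
  have hA : ∀ j x, J (Q₀.A j x) = backwardShift Y j (J x) := outputModel_A_apply hM hJ
  have hC : ∀ x, Q₀.C x = J x 0 := outputModel_C_apply
  have hc := isCommutative_of_backwardShift hA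
  have hi := isIsometricPair_of_backwardShift hA hC
  have hs := isStronglyStable_of_backwardShift hA hC
  have hG : ∀ (z : unitBall d) (y : Y),
      ((Q₀.outputTransfer z)†) y = (J.toContinuousLinearMap†) (kernel z y) := fun z y =>
    (hc.adjoint_observability_kernel (coeff_of_backwardShift hA hC) (hi.isUnit z) y).symm
  have hMk := isMultiplicationBy_iff.mp hM
  -- Here G(z)*y = J* k_z y and J J* = I - M M*.
  have hGG : ∀ (z w : unitBall d) (y y' : Y),
      ⟪((Q₀.outputTransfer z)†) y, ((Q₀.outputTransfer w)†) y'⟫_ℂ =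
        ⟪kernel z y, kernel w y'⟫_ℂ -
          ⟪kernel z (((S z.1)†) y), kernel w (((S w.1)†) y')⟫_ℂ := by
    intro z w y y'
    rw [hG, hG, ← hMk, ← hMk, ContinuousLinearMap.adjoint_inner_left,
      ContinuousLinearMap.adjoint_inner_left, ← inner_sub_right]
    congr 1
    exact eq_sub_of_add_eq (linearIsometry_adjoint_add hpi hJ (kernel w y'))
  let v : unitBall d × Y → WithLp 2 (PiLp 2 (fun _ : Fin d => X) × Y) := fun i =>
    WithLp.toLp 2 (((rowZ X i.1.1)†) (((Q₀.outputTransfer i.1)†) i.2), i.2)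
  let o : unitBall d := ⟨0, Metric.mem_ball_self one_pos⟩
  have hvo : ∀ y, v (o, y) = WithLp.toLp 2 (0, y) := fun y => by
    have : ((rowZ X o.1)†) (((Q₀.outputTransfer o)†) y) = 0 := by
      simp [o, rowZ_zero]
    simp only [v, this]
  obtain ⟨T, hT, hTiso, hT0, hTle⟩ := exists_partialIsometry_of_inner_eq v
    (fun i => (WithLp.toLp 2 (((Q₀.outputTransfer i.1)†) i.2, ((S i.1.1)†) i.2) :
      WithLp 2 (X × U))) (by
    rintro ⟨z, y⟩ ⟨w, y'⟩
    rw [WithLp.prod_inner_apply, WithLp.prod_inner_apply]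
    simp only [v, inner_adjoint_rowZ]
    have h1 := inner_kernel_kernel z w y y'
    have h2 := inner_kernel_kernel z w (((S z.1)†) y) (((S w.1)†) y')
    have h3 := hGG z w y y'
    linear_combination (1 - ∑ j, z.1 j * starRingEnd ℂ (w.1 j)) * h3 + h1 - h2)
  set Q := Q₀.withInput (WithLp.sndL 2 ℂ X U ∘L T) with hQ
  have hQT : ∀ a, (Q.connecting†) a = T a := by
    -- The U-components agree by the choice of B and D. The X-components agree on the vectors `v`;
    -- off their span T is zero, so [A* C*] must be shown to vanish there too.
    have hfst : ∀ a, (WithLp.fstL 2 ℂ X U ∘L (Q.connecting† - T)) a = 0 := by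
      refine eq_zero_of_apply_eq_zero v ?_ ?_
      · rintro ⟨z, y⟩
        rw [ContinuousLinearMap.comp_apply, sub_apply, hT]
        simp only [v]
        rw [adjoint_connecting_apply, map_sub]
        refine sub_eq_zero.mpr ?_
        exact adjoint_column_outputTransfer (Q := Q₀) (hi.isUnit z) y
      · intro a ha
        rw [ContinuousLinearMap.comp_apply, sub_apply, hT0 a ha, sub_zero]
        obtain ⟨⟨h, y⟩, rfl⟩ := (WithLp.toLp_surjective 2) a
        -- Orthogonality to `v (o, y')`, at the origin, forces y = 0.
        have hy : y = 0 := by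
          have h1 := ha (o, y)
          rw [hvo, WithLp.prod_inner_apply] at h1
          simpa using h1
        subst hy
        -- Orthogonality to `v (z, y)` says that ∑ z_j (J h_j)(z) = 0 at every z. Pairing this
        -- function with J x then gives A*h = 0.
        have hsum : ∑ j, ((backwardShift Y j)†) (J (h j)) = 0 := by
          refine ext_eval fun z => ext_inner_left ℂ fun y => ?_
          have h1 := ha (z, y)
          rw [WithLp.prod_inner_apply] at h1
          simp only [v, inner_zero_right, add_zero] at h1
          rw [hG, ContinuousLinearMap.adjoint_inner_left, ContinuousLinearMap.adjoint_inner_left,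
            ← adjoint_evalL, ContinuousLinearMap.adjoint_inner_left, rowZ_apply] at h1
          rw [map_zero, inner_zero_right, ← h1]
          simp only [map_sum, evalL_adjoint_backwardShift, map_smul]
          rfl
        rw [adjoint_connecting_apply, map_zero, map_zero, add_zero, add_zero]
        change ((column Q₀.A)†) h = 0
        refine ext_inner_right ℂ fun x => ?_
        rw [ContinuousLinearMap.adjoint_inner_left, PiLp.inner_apply, inner_zero_left]
        simp only [column_apply]
        simp_rw [← J.inner_map_map, hA, ← ContinuousLinearMap.adjoint_inner_left]
        rw [← sum_inner, hsum, inner_zero_left]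
    intro a
    have h1 : ((Q.connecting†) a).fst = (T a).fst := sub_eq_zero.mp (hfst a)
    have h2 : ((Q.connecting†) a).snd = (T a).snd := by
      obtain ⟨⟨h, y⟩, rfl⟩ := (WithLp.toLp_surjective 2) a
      rw [adjoint_connecting_apply]
      exact adjoint_withInput_apply Q₀ _ h y
    exact WithLp.ofLp_injective 2 (Prod.ext h1 h2)
  refine ⟨Q, realizes_iff.mpr fun z => ⟨hi.isUnit z, fun y => ?_⟩, ⟨fun a => ?_, ?_⟩, hc, hs, hi⟩
  · have h1 := adjoint_withInput_apply Q₀ (WithLp.sndL 2 ℂ X U ∘L T)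
      (((rowZ X z.1)†) (((Q₀.outputTransfer z)†) y)) y
    rw [ContinuousLinearMap.comp_apply] at h1
    have h2 := hT (z, y)
    simp only [v] at h2
    rw [h2] at h1
    exact h1
  · rw [hQT]; exact hTle a
  · intro h hh y
    rw [hQT]
    refine hTiso _ ?_
    set E := (Submodule.span ℂ (Set.range v)).topologicalClosure
    have hvE : ∀ i, v i ∈ E := fun i =>
      Submodule.le_topologicalClosure _ (Submodule.subset_span ⟨i, rfl⟩)
    let L : PiLp 2 (fun _ : Fin d => X) →L[ℂ] WithLp 2 (PiLp 2 (fun _ : Fin d => X) × Y) :=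
      ((WithLp.prodContinuousLinearEquiv 2 ℂ (PiLp 2 (fun _ : Fin d => X)) Y).symm :
      PiLp 2 (fun _ : Fin d => X) × Y →L[ℂ] WithLp 2 (PiLp 2 (fun _ : Fin d => X) × Y)) ∘L
      ContinuousLinearMap.inl ℂ _ _
    have hL : ∀ h, L h = WithLp.toLp 2 (h, 0) := fun h => rfl
    -- Subtracting `v (o, y) = (0, y)` from `v (z, y)` isolates the first component, so the closed
    -- span of `v` contains the whole direct sum with Y.
    have hle : Q.coisometricDomain ≤ E.comap (L : _ →ₗ[ℂ] _) := by
      rw [coisometricDomain_eq]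
      refine Submodule.topologicalClosure_minimal _ ?_
        ((Submodule.isClosed_topologicalClosure _).preimage L.continuous)
      rw [Submodule.span_le]
      rintro _ ⟨z, y, rfl⟩
      have h1 : L (((rowZ X z.1)†) (((Q.outputTransfer z)†) y)) = v (z, y) - v (o, y) := by
        rw [hvo, hL]
        change _ = WithLp.toLp 2 ((_, y) - (0, y))
        rw [Prod.mk_sub_mk, sub_zero, sub_self]
        rfl
      change L _ ∈ E
      rw [h1]
      exact E.sub_mem (hvE _) (hvE _)
    have h2 : WithLp.toLp 2 (h, y) = L h + v (o, y) := by
      rw [hvo, hL]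
      change _ = WithLp.toLp 2 ((h, 0) + (0, y))
      rw [Prod.mk_add_mk, add_zero, zero_add]
    rw [h2]
    exact E.add_mem (hle hh) (hvE _)

end Colligation

end Range

end

end DruryArveson

end

theorem theoremT (d : ℕ)
    {U : Type u} [NormedAddCommGroup U] [InnerProductSpace ℂ U] [CompleteSpace U]
    {Y : Type v} [NormedAddCommGroup Y] [InnerProductSpace ℂ Y] [CompleteSpace Y]
    (S : EuclideanSpace ℂ (Fin d) → U →L[ℂ] Y) :
    DruryArveson.IsInnerMultiplier S ↔
      ∃ (X : Type (max v w)) (_ : NormedAddCommGroup X) (_ : InnerProductSpace ℂ X)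
        (_ : CompleteSpace X) (Q : DruryArveson.Colligation d U X Y),
        Q.Realizes S ∧ Q.IsWeaklyCoisometric ∧
          Q.IsCommutative ∧ Q.IsStronglyStable ∧ Q.IsIsometricPair := by
  constructor
  · rintro ⟨-, M, hM, -, hpi⟩
    -- The state space is ker M*, transported isometrically to the required universe.
    let K : Submodule ℂ (DruryArveson.Space d Y) :=
      LinearMap.ker (M† : DruryArveson.Space d Y →ₗ[ℂ] DruryArveson.Space d U)
    have hK : IsClosed (K : Set (DruryArveson.Space d Y)) := (M†).isClosed_ker
    have : CompleteSpace K := hK.completeSpace_coe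
    obtain ⟨X, _, _, _, ⟨e⟩⟩ := DruryArveson.exists_linearIsometryEquiv_lift.{v, w} K
    refine ⟨X, inferInstance, inferInstance, inferInstance,
      DruryArveson.Colligation.exists_realization
        (J := K.subtypeₗᵢ.comp e.toLinearIsometry) hM hpi fun f => ⟨?_, fun hf => ?_⟩⟩
    · rintro ⟨x, rfl⟩
      exact (e x).2
    · exact ⟨e.symm ⟨f, hf⟩, by simp⟩
  · rintro ⟨X, _, _, _, Q, hS, hw, hc, hs, hi⟩
    exact DruryArveson.Colligation.isInnerMultiplier hS hw hc hs hi
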